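/- Let $d, m, n\ge 0$ be integers with $n\le m$, and let $\mathcal F=\{f_1,\dots,f_m\}$ be a finite family in $L^2(\mathbb R^d)$ (complex valued). Write $\hat f$ for the Fourier transform on $L^2(\mathbb R^d)$, normalized by $\hat f(\omega)=\int_{\mathbb R^d} f(x)e^{-2\pi i x^t\omega}\,dx$. For $\varphi_1,\dots,\varphi_s\in L^2(\mathbb R^d)$ let $\mathcal S(\varphi_1,\dots,\varphi_s)$ be the closed linear span in $L^2(\mathbb R^d)$ of all integer translates $\varphi_i(\cdot-k)$, $k\in\mathbb Z^d$, $1\le i\le s$, and let $\mathcal V_n$ be the set of all spaces $\mathcal S(\varphi_1,\dots,\varphi_s)$ with $s\le n$. For a closed subspace $V$ let $P_V$ be the orthogonal projection onto $V$. A space $V\in\mathcal V_n$ is called optimal if $\sum_{i=1}^m\|f_i-P_Vf_i\|^2\le\sum_{i=1}^m\|f_i-P_{V'}f_i\|^2$ for all $V'\in\mathcal V_n$. Fix measurable representatives of $\hat f_1,\dots,\hat f_m$ and let $G_{\mathcal F}(\omega)$ be the Gramian, the self-adjoint $m\times m$ matrix with entries $$[G_{\mathcal F}(\omega)]_{i,j}=\sum_{k\in\mathbb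 Z^d}\hat f_i(\omega+k)\overline{\hat f_j(\omega+k)},$$ an entry being set to $0$ on the null set of those $\omega$ at which its series does not converge absolutely. Let $\lambda_1(\omega)\ge\dots\ge\lambda_m(\omega)$ be the eigenvalues of $G_{\mathcal F}(\omega)$, counted with multiplicity. Then: 1. The functions $\lambda_i$, $1\le i\le m$, are $\mathbb Z^d$-periodic, measurable, and integrable on $[0,1]^d$, and the minimum $$\mathcal E(\mathcal F,n)=\min_{V'\in\mathcal V_n}\sum_{i=1}^m\|f_i-P_{V'}f_i\|^2$$ is attained and equals $$\mathcal E(\mathcal F,n)=\sum_{i=n+1}^m\int_{[0,1]^d}\lambda_i(\omega)\,d\omega .$$ 2. Let $\tilde\sigma_i(\omega)=\lambda_i(\omega)^{-1/2}$ where $\lambda_i(\omega)\ne0$, and $\tilde\sigma_i(\omega)=0$ elsewhere (almost everywhere $\lambda_i\ge 0$). There are measurable functions $y_i=(y_{i1},\dots,y_{im})^t:\mathbb R^d\to\mathbb C^m$, $i=1,\dots,n$, such that for every $\omega$ the vectors $y_1(\omega),\dots,y_n(\omega)$ are orthonormal, $y_i(\omega)^tG_{\mathcal F}(\omega)=\lambda_i(\omega)\,y_i(\omega)^t$,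 and the following holds. The functions $$h_i(\omega)=\tilde\sigma_i(\omega)\sum_{j=1}^m y_{ij}(\omega)\hat f_j(\omega),\qquad i=1,\dots,n,$$ are in $L^2(\mathbb R^d)$, and for the functions $\varphi_1,\dots,\varphi_n\in L^2(\mathbb R^d)$ with $\hat\varphi_i=h_i$ the space $V=\mathcal S(\varphi_1,\dots,\varphi_n)$ is optimal and the family $\{\varphi_i(\cdot-k): k\in\mathbb Z^d,\ i=1,\dots,n\}$ is a Parseval frame for $V$: its members lie in $V$, and $\sum_{i,k}|\langle g,\varphi_i(\cdot-k)\rangle|^2=\|g\|^2$ for all $g\in V$. -/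

import Mathlib

open MeasureTheory
open scoped FourierTransform

noncomputable section

namespace ShiftInvariant

/-- The Euclidean space `ℝ^d`. -/
abbrev Rd (d : ℕ) : Type := EuclideanSpace ℝ (Fin d)

/-- The complex Hilbert space `L²(ℝ^d)`. -/
abbrev L2 (d : ℕ) : Type := Lp (α := Rd d) ℂ 2 volume

/-- The integer vector `k ∈ ℤ^d`, seen as a point of `ℝ^d`. -/
def intVec {d : ℕ} (k : Fin d → ℤ) : Rd d := WithLp.toLp 2 fun i => (k i : ℝ)

/-- The translate `x ↦ φ (x - k)` of `φ ∈ L²(ℝ^d)` by `k ∈ ℤ^d`. -/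
def translate {d : ℕ} (k : Fin d → ℤ) (φ : L2 d) : L2 d :=
  Lp.compMeasurePreserving (fun x : Rd d => x - intVec k)
    (measurePreserving_sub_right volume (intVec k)) φ

/-- The shift-invariant space generated by `φ_1, …, φ_s`: the closed linear span in `L²(ℝ^d)` of
all the integer translates `φ_i(· - k)`. -/
def siSpace {d s : ℕ} (φ : Fin s → L2 d) : ClosedSubmodule ℂ (L2 d) :=
  (Submodule.span ℂ
    (Set.range fun p : Fin s × (Fin d → ℤ) => translate p.2 (φ p.1))).closure

/-- The class of all shift-invariant spaces which have a set of at most `n` generators. -/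
def siSpaces (d n : ℕ) : Set (ClosedSubmodule ℂ (L2 d)) :=
  {V | ∃ s : ℕ, s ≤ n ∧ ∃ φ : Fin s → L2 d, V = siSpace φ}

/-- The error `∑ ‖f_i - P_V f_i‖²`, with `P_V` the orthogonal projection of `L²(ℝ^d)` onto `V`. -/
def approxError {d m : ℕ} (f : Fin m → L2 d) (V : ClosedSubmodule ℂ (L2 d)) : ℝ :=
  ∑ i, ‖f i - V.toSubmodule.starProjection (f i)‖ ^ 2

/-- `V` is an optimal space for the data `f_1, …, f_m` among the shift-invariant spaces with at
most `n` generators. -/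
def IsOptimal {d m : ℕ} (f : Fin m → L2 d) (n : ℕ) (V : ClosedSubmodule ℂ (L2 d)) : Prop :=
  V ∈ siSpaces d n ∧ ∀ V' ∈ siSpaces d n, approxError f V ≤ approxError f V'

/-- The family `u` is a Parseval frame for the closed subspace `V` : its members lie in `V`, and
`∑ |⟨g, u_i⟩|² = ‖g‖²` for every `g ∈ V`. -/
def IsParsevalFrame {H ι : Type*} [NormedAddCommGroup H] [InnerProductSpace ℂ H]
    (u : ι → H) (V : ClosedSubmodule ℂ H) : Prop :=
  (∀ i, u i ∈ V) ∧ ∀ g ∈ V, HasSum (fun i => ‖inner ℂ g (u i)‖ ^ 2) (‖g‖ ^ 2)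

/-- The Gramian of `f_1, …, f_m ∈ L²(ℝ^d)`, the matrix-valued function with the entries
`∑_{k ∈ ℤ^d} f̂_i(ω + k) * conj (f̂_j(ω + k))`. Here `𝓕` is the Fourier transform of `L²(ℝ^d)`,
normalized by `f̂(ω) = ∫ f(x) exp(-2πi ⟨x, ω⟩) dx`. -/
def gramian {d m : ℕ} (f : Fin m → L2 d) (ω : Rd d) : Matrix (Fin m) (Fin m) ℂ :=
  Matrix.of fun i j =>
    ∑' k : Fin d → ℤ, (𝓕 (f i) : L2 d) (ω + intVec k) * star ((𝓕 (f j) : L2 d) (ω + intVec k))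

theorem gramian_isHermitian {d m : ℕ} (f : Fin m → L2 d) (ω : Rd d) :
    (gramian f ω).IsHermitian := by
  ext i j
  simp only [gramian, Matrix.conjTranspose_apply, Matrix.of_apply, tsum_star, star_mul, star_star]

/-- The eigenvalues of the Gramian at `ω`, counted with multiplicity, in decreasing order. The
index `i : Fin m` is zero-based: `gramEigenvalue f 0 ω` is the largest eigenvalue. -/
def gramEigenvalue {d m : ℕ} (f : Fin m → L2 d) (i : Fin m) (ω : Rd d) : ℝ :=
  (gramian_isHermitian f ω).eigenvalues₀ (Fin.cast (Fintype.card_fin m).symm i)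

/-- The unit cube `[0,1]^d`. -/
def unitCube (d : ℕ) : Set (Rd d) := {ω | ∀ i, ω i ∈ Set.Icc (0 : ℝ) 1}

/-- `σ̃_i(ω)`, which is `λ_i(ω)^(-1/2)` where `λ_i(ω) ≠ 0` and is `0` elsewhere. -/
def sigmaTilde {d m : ℕ} (f : Fin m → L2 d) (i : Fin m) (ω : Rd d) : ℝ :=
  if gramEigenvalue f i ω = 0 then 0 else gramEigenvalue f i ω ^ (-(1 / 2) : ℝ)

end ShiftInvariant

end

open ShiftInvariant

namespace ShiftInvariant

/-! ### Measurable selection from compact zero sets -/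

/-! Sending `g` to the sequences `k ↦ ĝ(ω + k)` embeds L²(ℝ^d) isometrically into the ℓ²(ℤ^d)-valued
functions on the unit cube, by Plancherel and the tiling of ℝ^d by cubes
(`integral_inner_spectralFiber`). Translation by `k` becomes multiplication by the scalar
exp(-2πi⟨k,ω⟩), so the fibers of a space with `s` generators lie, at almost every ω, in a subspace
of dimension at most `s` (`spectralFiber_mem_of_mem_siSpace`). The Gramian at ω is the Gram matrix
of the data fibers. The problem thus splits into approximating `m` vectors by a subspace of
dimension at most `n`, separately at each ω. Eckart–Young bounds the error there below by the tail
of the eigenvalues (`DiagonalizesGram.sum_tail_le`), and integration gives the lower bound.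

The bound is attained because the normalized combinations of the data with the leading eigenvectors
have pairwise orthogonal fibers of norm zero or one. The inner products of `g` with their translates
are Fourier coefficients of functions on the cube, so Parseval on the torus
(`hasSum_sq_inner_translate`) yields both the frame property and the projection error, which is the
eigenvalue tail (`IsEigenframe.approxError_eq`).

What remains is a measurable choice of eigenvectors, also where eigenvalues collide. The ordered
diagonalizations of a Hermitian matrix are the zeros of a continuous function on the compact unitary
group, and one is picked by minimizing the coordinates one after another
(`exists_measurable_eigenvectors`). The choice depends on the matrix alone, hence is periodic in ω,
and periodic factors act as scalars on fibers. -/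

theorem measurableSet_exists_zero {X Y : Type*} [MeasurableSpace X] [TopologicalSpace Y]
    [CompactSpace Y] [SecondCountableTopology Y] {F : X → Y → ℝ}
    (hc : ∀ x, Continuous (F x)) (hm : ∀ y, Measurable fun x => F x y) (h0 : ∀ x y, 0 ≤ F x y)
    {C : Set Y} (hC : IsClosed C) : MeasurableSet {x | ∃ y ∈ C, F x y = 0} := by
  obtain ⟨D, hDc, hD⟩ := TopologicalSpace.exists_countable_dense C
  -- By compactness a zero exists in `C` exactly when `F x` takes arbitrarily small values there,
  -- and continuity lets a countable dense subset detect this.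
  have : {x | ∃ y ∈ C, F x y = 0} =
      ⋂ n : ℕ, ⋃ y ∈ D, {x | F x (y : C) < 1 / ((n : ℝ) + 1)} := by
    ext x
    simp only [Set.mem_ofPred_eq, Set.mem_iInter, Set.mem_iUnion, exists_prop]
    constructor
    · rintro ⟨y, hy, hxy⟩ n
      have hopen : IsOpen {z : C | F x z < 1 / ((n : ℝ) + 1)} :=
        isOpen_lt ((hc x).comp continuous_subtype_val) continuous_const
      obtain ⟨z, hz, hzD⟩ := hD.inter_open_nonempty _ hopen
        ⟨⟨y, hy⟩, by simp only [Set.mem_ofPred_eq, hxy]; positivity⟩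
      exact ⟨z, hzD, hz⟩
    · intro h
      obtain ⟨z, -, -⟩ := h 0
      obtain ⟨y, hyC, hy⟩ := hC.isCompact.exists_isMinOn ⟨z, z.2⟩ (hc x).continuousOn
      refine ⟨y, hyC, le_antisymm (le_of_forall_pos_le_add fun ε hε => ?_) (h0 x y)⟩
      obtain ⟨n, hn⟩ := exists_nat_one_div_lt hε
      obtain ⟨z, -, hz⟩ := h n
      have := hy z.2
      simp only [Set.mem_ofPred_eq] at this
      linarith
  rw [this]
  exact MeasurableSet.iInter fun n => MeasurableSet.biUnion hDc fun y _ =>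
    measurableSet_lt (hm y) measurable_const

/-- The value is the minimum of `g` over the zero set: it is at most `a` exactly when the closed set
`g ≤ a` contains a zero. The minimizer itself need not depend measurably on `x`. -/
theorem exists_measurable_value_on_zeros {X Y : Type*} [MeasurableSpace X] [TopologicalSpace Y]
    [CompactSpace Y] [SecondCountableTopology Y] {F : X → Y → ℝ}
    (hc : ∀ x, Continuous (F x)) (hm : ∀ y, Measurable fun x => F x y) (h0 : ∀ x y, 0 ≤ F x y)
    (hex : ∀ x, ∃ y, F x y = 0) {g : Y → ℝ} (hg : Continuous g) :
    ∃ t : X → ℝ, Measurable t ∧ ∀ x, ∃ y, F x y = 0 ∧ g y = t x := by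
  have hmin : ∀ x, ∃ y, F x y = 0 ∧ ∀ z, F x z = 0 → g y ≤ g z := fun x => by
    have hcl : IsClosed {y | F x y = 0} := isClosed_eq (hc x) continuous_const
    obtain ⟨y, hy, hy'⟩ := hcl.isCompact.exists_isMinOn (hex x) hg.continuousOn
    exact ⟨y, hy, fun z hz => hy' hz⟩
  choose y hy hy' using hmin
  refine ⟨fun x => g (y x), measurable_of_Iic fun a => ?_, fun x => ⟨y x, hy x, rfl⟩⟩
  convert! measurableSet_exists_zero hc hm h0 (isClosed_le hg (continuous_const (y := a))) using 1
  ext x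
  exact ⟨fun h => ⟨y x, h, hy x⟩, fun ⟨z, hz, hz0⟩ => (hy' x z hz0).trans hz⟩

theorem exists_measurable_values_on_zeros {X Y : Type*} [MeasurableSpace X] [TopologicalSpace Y]
    [CompactSpace Y] [SecondCountableTopology Y] (N : ℕ) {F : X → Y → ℝ}
    (hc : ∀ x, Continuous (F x)) (hm : ∀ y, Measurable fun x => F x y) (h0 : ∀ x y, 0 ≤ F x y)
    (hex : ∀ x, ∃ y, F x y = 0) {g : Fin N → Y → ℝ} (hg : ∀ i, Continuous (g i)) :
    ∃ t : Fin N → X → ℝ, (∀ i, Measurable (t i)) ∧ ∀ x, ∃ y, F x y = 0 ∧ ∀ i, g i y = t i x := by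
  induction N generalizing F with
  | zero => exact ⟨fun i => i.elim0, fun i => i.elim0, fun x =>
      (hex x).imp fun y hy => ⟨hy, fun i => i.elim0⟩⟩
  | succ N ih =>
    obtain ⟨t₀, ht₀, h⟩ := exists_measurable_value_on_zeros hc hm h0 hex (hg 0)
    -- The added penalty cuts the zero set down to the points with `g 0 y = t₀ x`, so later choices
    -- keep the values already fixed.
    obtain ⟨t, ht, h'⟩ := ih (F := fun x y => F x y + |g 0 y - t₀ x|) (g := fun i => g i.succ)
      (fun x => (hc x).add ((hg 0).sub continuous_const).abs)
      (fun y => (hm y).add (measurable_const.sub ht₀).abs)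
      (fun x y => add_nonneg (h0 x y) (abs_nonneg _))
      (fun x => (h x).imp fun y hy => by simp [hy.1, hy.2]) (fun i => hg i.succ)
    refine ⟨Fin.cons t₀ t, Fin.cases ht₀ ht, fun x => ?_⟩
    obtain ⟨y, hy, hy'⟩ := h' x
    obtain ⟨h1, h2⟩ := (add_eq_zero_iff_of_nonneg (h0 x y) (abs_nonneg _)).1 hy
    exact ⟨y, h1, Fin.cases (sub_eq_zero.1 (abs_eq_zero.1 h2)) hy'⟩

theorem exists_measurable_complex_values_on_zeros {X Y ι : Type*} [MeasurableSpace X]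
    [TopologicalSpace Y] [CompactSpace Y] [SecondCountableTopology Y] [Finite ι] {F : X → Y → ℝ}
    (hc : ∀ x, Continuous (F x)) (hm : ∀ y, Measurable fun x => F x y) (h0 : ∀ x y, 0 ≤ F x y)
    (hex : ∀ x, ∃ y, F x y = 0) {g : ι → Y → ℂ} (hg : ∀ i, Continuous (g i)) :
    ∃ t : ι → X → ℂ, (∀ i, Measurable (t i)) ∧ ∀ x, ∃ y, F x y = 0 ∧ ∀ i, g i y = t i x := by
  obtain ⟨N, ⟨e⟩⟩ := Finite.exists_equiv_fin (ι ⊕ ι)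
  obtain ⟨t, ht, h⟩ := exists_measurable_values_on_zeros N hc hm h0 hex
    (g := fun i => Sum.elim (fun j y => (g j y).re) (fun j y => (g j y).im) (e.symm i))
    (fun i => by
      rcases e.symm i with j | j
      exacts [Complex.continuous_re.comp (hg j), Complex.continuous_im.comp (hg j)])
  refine ⟨fun i x => ⟨t (e (.inl i)) x, t (e (.inr i)) x⟩, fun i => ?_, fun x => ?_⟩
  · have : (fun x => (⟨t (e (.inl i)) x, t (e (.inr i)) x⟩ : ℂ)) =
        fun x => (t (e (.inl i)) x : ℂ) + t (e (.inr i)) x * Complex.I := by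
      ext x; exact Complex.mk_eq_add_mul_I _ _
    change Measurable fun x => (⟨t (e (.inl i)) x, t (e (.inr i)) x⟩ : ℂ)
    rw [this]
    have h1 := ht (e (.inl i))
    have h2 := ht (e (.inr i))
    fun_prop
  · obtain ⟨y, hy, hy'⟩ := h x
    refine ⟨y, hy, fun i => Complex.ext ?_ ?_⟩
    · simpa using hy' (e (.inl i))
    · simpa using hy' (e (.inr i))

/-! ### Measurable diagonalization of Hermitian matrices -/

/-- The families of `m` orthonormal row vectors in `ℂ^m`. -/
abbrev Frames (m : ℕ) : Type :=
  {U : Fin m → Fin m → ℂ // ∀ a b, ∑ j, U a j * star (U b j) = if a = b then 1 else 0}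

instance (m : ℕ) : CompactSpace (Frames m) := by
  refine isCompact_iff_compactSpace.1 (Metric.isCompact_of_isClosed_isBounded ?_ ?_)
  · have : {U : Fin m → Fin m → ℂ |
        ∀ a b, ∑ j, U a j * star (U b j) = if a = b then 1 else 0} =
        ⋂ a, ⋂ b, {U | ∑ j, U a j * star (U b j) = if a = b then 1 else 0} := by
      ext; simp
    change IsClosed {U : Fin m → Fin m → ℂ |
        ∀ a b, ∑ j, U a j * star (U b j) = if a = b then 1 else 0}
    rw [this]
    refine isClosed_iInter fun a => isClosed_iInter fun b =>
      isClosed_eq ?_ continuous_const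
    exact continuous_finsetSum _ fun j _ =>
      (continuous_apply_apply a j).mul (continuous_apply_apply b j).star
  · refine (Metric.isBounded_closedBall (x := 0) (r := 1)).subset fun U hU => ?_
    rw [mem_closedBall_zero_iff, pi_norm_le_iff_of_nonneg zero_le_one]
    refine fun a => (pi_norm_le_iff_of_nonneg zero_le_one).2 fun j => ?_
    have h : ∑ j, ‖U a j‖ ^ 2 = 1 := by
      have := hU a a
      simp only [if_true, RCLike.star_def, RCLike.mul_conj] at this
      rw [← Complex.ofReal_inj]
      push_cast
      exact this
    have h1 : ‖U a j‖ ^ 2 ≤ 1 :=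
      h ▸ Finset.single_le_sum (f := fun j => ‖U a j‖ ^ 2) (fun _ _ => by positivity)
        (Finset.mem_univ j)
    exact (sq_le_one_iff₀ (norm_nonneg _)).1 h1

open Matrix in
-- Unitary conjugation preserves the characteristic polynomial, so both sides list the same roots in
-- decreasing order.
theorem eigenvalues₀_eq_of_unitary_diagonal {m : ℕ} {A U : Matrix (Fin m) (Fin m) ℂ}
    (hA : A.IsHermitian) (hU : U * Uᴴ = 1) {r : Fin m → ℝ} (hr : Antitone r)
    (h : U * A * Uᴴ = diagonal fun i => (r i : ℂ)) (i : Fin m) :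
    hA.eigenvalues₀ (Fin.cast (Fintype.card_fin m).symm i) = r i := by
  have hU' : Uᴴ * U = 1 := mul_eq_one_comm.1 hU
  have hchar : A.charpoly = ∏ i, (Polynomial.X - Polynomial.C (r i : ℂ)) := by
    rw [← charpoly_diagonal, ← h, charpoly_mul_comm, ← Matrix.mul_assoc, hU', Matrix.one_mul]
  have hroots : A.charpoly.roots.map RCLike.re = Multiset.map r Finset.univ.val := by
    rw [hchar, Polynomial.roots_prod]
    · simp [Function.comp_def]
    · simp [Finset.prod_ne_zero_iff, Polynomial.X_sub_C_ne_zero]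
  have hsort := hA.sort_roots_charpoly_eq_eigenvalues₀
  rw [hroots] at hsort
  have hl : (Multiset.map r Finset.univ.val).sort (· ≥ ·) = List.ofFn r := by
    rw [Fin.univ_val_map, Multiset.coe_sort]
    apply List.mergeSort_of_pairwise
    simp_rw [decide_eq_true_eq, ← List.sortedGE_iff_pairwise]
    exact hr.sortedGE_ofFn
  rw [hl] at hsort
  have h1 := congrArg (fun l : List ℝ => l[(i : ℕ)]?) hsort
  simp only [List.getElem?_ofFn] at h1
  simpa [Fin.cast] using h1.symm

/-- The Hermitian matrices, with the measurable structure of `ℂ^{m × m}`. -/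
abbrev HermitianMatrix (m : ℕ) : Type :=
  {A : Fin m → Fin m → ℂ // (Matrix.of A).IsHermitian}

open Matrix in
theorem exists_measurable_eigenvectors (m : ℕ) :
    ∃ y : HermitianMatrix m → Fin m → Fin m → ℂ, Measurable y ∧
      (∀ A a b, ∑ j, y A a j * star (y A b j) = if a = b then 1 else 0) ∧
      ∀ A a, vecMul (y A a) (of A.1) =
        (A.2.eigenvalues₀ (Fin.cast (Fintype.card_fin m).symm a) : ℂ) • y A a := by
  set D : HermitianMatrix m → Frames m → Fin m → Fin m → ℂ :=
    fun A U a b => ∑ j, ∑ k, U.1 a j * A.1 j k * star (U.1 b k) with hD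
  have hent : ∀ a j, Continuous fun U : Frames m => U.1 a j := fun a j =>
    (continuous_apply_apply a j).comp continuous_subtype_val
  have hDc : ∀ A a b, Continuous fun U => D A U a b := fun A a b => by
    exact continuous_finsetSum _ fun j _ => continuous_finsetSum _ fun k _ =>
      (((hent a j).mul continuous_const).mul (hent b k).star)
  have hDm : ∀ U a b, Measurable fun A => D A U a b := fun U a b => by
    simp only [hD]
    refine Finset.measurable_sum _ fun j _ => Finset.measurable_sum _ fun k _ => ?_
    have : Measurable fun A : HermitianMatrix m => A.1 j k :=
      (measurable_pi_apply k).comp ((measurable_pi_apply j).comp measurable_subtype_coe)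
    exact (measurable_const.mul this).mul measurable_const
  have hDmat : ∀ A U a b, D A U a b = (of U.1 * of A.1 * (of U.1)ᴴ) a b := fun A U a b => by
    simp only [hD, mul_apply, of_apply, conjTranspose_apply, Finset.sum_mul]
    exact Finset.sum_comm
  have hUU : ∀ U : Frames m, of U.1 * (of U.1)ᴴ = 1 := fun U => by
    ext a b
    simp only [mul_apply, of_apply, conjTranspose_apply, U.2, one_apply]
  -- The penalty charges off-diagonal entries of `U A Uᴴ` and diagonal entries out of order; its
  -- zeros are the ordered diagonalizations.
  set F : HermitianMatrix m → Frames m → ℝ := fun A U =>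
    ∑ a, ∑ b, ((if a = b then 0 else ‖D A U a b‖) +
      if a ≤ b then max 0 ((D A U b b).re - (D A U a a).re) else 0) with hF
  have hFc : ∀ A, Continuous (F A) := fun A => by
    simp only [hF]
    refine continuous_finsetSum _ fun a _ => continuous_finsetSum _ fun b _ => ?_
    have h1 := hDc A a b
    have h2 := hDc A a a
    have h3 := hDc A b b
    split_ifs <;> fun_prop
  have hFm : ∀ U, Measurable fun A => F A U := fun U => by
    simp only [hF]
    refine Finset.measurable_sum _ fun a _ => Finset.measurable_sum _ fun b _ => ?_
    have h1 := hDm U a b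
    have h2 := hDm U a a
    have h3 := hDm U b b
    split_ifs <;> fun_prop
  have hterm : ∀ A U a b, 0 ≤ (if a = b then 0 else ‖D A U a b‖) +
      if a ≤ b then max 0 ((D A U b b).re - (D A U a a).re) else 0 := fun A U a b => by
    split_ifs <;> positivity
  have hF0 : ∀ A U, 0 ≤ F A U := fun A U =>
    Finset.sum_nonneg fun a _ => Finset.sum_nonneg fun b _ => hterm A U a b
  have hFiff : ∀ A U, F A U = 0 ↔ (∀ a b, a ≠ b → D A U a b = 0) ∧
      ∀ a b, a ≤ b → (D A U b b).re ≤ (D A U a a).re := fun A U => by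
    simp only [hF]
    rw [Finset.sum_eq_zero_iff_of_nonneg
      fun a _ => Finset.sum_nonneg fun b _ => hterm A U a b]
    simp only [Finset.mem_univ, true_implies]
    have : ∀ a, (∑ b, ((if a = b then 0 else ‖D A U a b‖) +
        if a ≤ b then max 0 ((D A U b b).re - (D A U a a).re) else 0)) = 0 ↔
        ∀ b, (a ≠ b → D A U a b = 0) ∧ (a ≤ b → (D A U b b).re ≤ (D A U a a).re) := fun a => by
      rw [Finset.sum_eq_zero_iff_of_nonneg fun b _ => hterm A U a b]
      simp only [Finset.mem_univ, true_implies]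
      refine forall_congr' fun b => ?_
      rw [add_eq_zero_iff_of_nonneg (by split_ifs <;> positivity) (by split_ifs <;> positivity)]
      simp
    simp only [this, forall_and]
  have hex : ∀ A, ∃ U, F A U = 0 := fun A => by
    have e := (isSymmetric_toEuclideanLin_iff.mpr A.2)
    set b := e.eigenvectorBasis (finrank_euclideanSpace_fin (𝕜 := ℂ) (n := m)) with hb
    have hbA : ∀ a j, ∑ k, A.1 j k * b a k =
        (e.eigenvalues finrank_euclideanSpace_fin a : ℂ) * b a j := fun a j => by
      have := e.apply_eigenvectorBasis finrank_euclideanSpace_fin a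
      have := congrArg (fun v : EuclideanSpace ℂ (Fin m) => v j) this
      simpa [-LinearMap.IsSymmetric.apply_eigenvectorBasis, mulVec, dotProduct] using this
    have hon : ∀ a a', ∑ j, star (b a j) * b a' j = if a = a' then 1 else 0 := fun a a' => by
      have := orthonormal_iff_ite.1 b.orthonormal a a'
      rw [← this, PiLp.inner_apply]
      simp [mul_comm]
    -- The right eigenvectors are conjugated to become rows: then the entries of `U A Uᴴ` are the
    -- products ⟨b a, A b a'⟩.
    refine ⟨⟨fun a j => star (b a j), fun a a' => ?_⟩, ?_⟩
    · simpa using hon a a'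
    have hDv : ∀ a a', D A ⟨fun a j => star (b a j), fun a a' => by simpa using hon a a'⟩ a a' =
        if a = a' then (e.eigenvalues finrank_euclideanSpace_fin a : ℂ) else 0 := fun a a' => by
      simp only [hD, star_star, mul_assoc, ← Finset.mul_sum, hbA]
      simp only [mul_left_comm _ (e.eigenvalues _ _ : ℂ), ← Finset.mul_sum, hon]
      split_ifs with h
      · simp [h]
      · simp
    rw [hFiff]
    refine ⟨fun a a' h => by rw [hDv, if_neg h], fun a a' h => ?_⟩
    rw [hDv, hDv, if_pos rfl, if_pos rfl, Complex.ofReal_re, Complex.ofReal_re]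
    exact e.eigenvalues_antitone _ h
  -- All entries of `U` serve as test functions, so the selected values determine the frame itself.
  obtain ⟨t, ht, hsel⟩ := exists_measurable_complex_values_on_zeros hFc hFm hF0 hex
    (g := fun (p : Fin m × Fin m) U => U.1 p.1 p.2) (fun p => hent p.1 p.2)
  have key : ∀ A, ∃ U : Frames m, F A U = 0 ∧ U.1 = fun a j => t (a, j) A := fun A => by
    obtain ⟨U, hU, hUt⟩ := hsel A
    exact ⟨U, hU, by ext a j; exact hUt (a, j)⟩
  refine ⟨fun A a j => t (a, j) A,
    measurable_pi_lambda _ fun a => measurable_pi_lambda _ fun j => ht (a, j), fun A => ?_,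
    fun A => ?_⟩
  · obtain ⟨U, -, hU⟩ := key A
    simpa only [hU] using U.2
  · obtain ⟨U, hU0, hU⟩ := key A
    rw [hFiff] at hU0
    have hherm : (of U.1 * of A.1 * (of U.1)ᴴ).IsHermitian :=
      isHermitian_mul_mul_conjTranspose _ A.2
    have hdiag : of U.1 * of A.1 * (of U.1)ᴴ =
        diagonal fun a => ((D A U a a).re : ℂ) := by
      ext a b
      rw [diagonal_apply]
      split_ifs with h
      · subst h
        rw [← hherm.coe_re_apply_self a, ← hDmat]; rfl
      · rw [← hDmat, hU0.1 a b h]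
    have hlam := eigenvalues₀_eq_of_unitary_diagonal A.2 (hUU U) (fun a b h => hU0.2 a b h) hdiag
    have hrow : of U.1 * of A.1 = diagonal (fun a => ((D A U a a).re : ℂ)) * of U.1 := by
      rw [← hdiag, Matrix.mul_assoc _ _ (of U.1), mul_eq_one_comm.1 (hUU U), Matrix.mul_one]
    intro a
    rw [hlam a]
    ext j
    have := congrFun (congrFun hrow a) j
    rw [diagonal_mul, mul_apply] at this
    simpa [vecMul, dotProduct, hU] using this

/-! ### Families with orthogonal members of norm zero or one -/

section PartialOrthonormal

open scoped InnerProductSpace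

variable {H ι : Type*} [NormedAddCommGroup H] [InnerProductSpace ℂ H]

theorem inner_self_eq_ofReal (x : H) : ⟪x, x⟫_ℂ = ((‖x‖ ^ 2 : ℝ) : ℂ) := by
  rw [inner_self_eq_norm_sq_to_K, Complex.ofReal_pow]
  rfl

theorem ofReal_norm_sq (z : ℂ) : ((‖z‖ ^ 2 : ℝ) : ℂ) = star z * z := by
  rw [Complex.ofReal_pow]
  exact (RCLike.conj_mul z).symm

/-- A family of pairwise orthogonal vectors, each of which is zero or a unit vector. -/
def PartialOrthonormal [DecidableEq ι] (Φ : ι → H) (e : ι → Prop) [DecidablePred e] : Prop :=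
  ∀ a b, ⟪Φ a, Φ b⟫_ℂ = if a = b then if e a then 1 else 0 else 0

variable [DecidableEq ι] {Φ : ι → H} {e : ι → Prop} [DecidablePred e]

theorem PartialOrthonormal.sum_sq_inner_of_mem_span [Fintype ι] (hΦ : PartialOrthonormal Φ e)
    {h : H} (hh : h ∈ Submodule.span ℂ (Set.range Φ)) : ∑ a, ‖⟪Φ a, h⟫_ℂ‖ ^ 2 = ‖h‖ ^ 2 := by
  obtain ⟨x, rfl⟩ := (Submodule.mem_span_range_iff_exists_fun ℂ).1 hh
  have h1 : ∀ a, ⟪Φ a, ∑ b, x b • Φ b⟫_ℂ = if e a then x a else 0 := fun a => by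
    simp [hΦ a]
  have h2 : ((‖∑ b, x b • Φ b‖ ^ 2 : ℝ) : ℂ) = ((∑ a, ‖if e a then x a else 0‖ ^ 2 : ℝ) : ℂ) := by
    rw [← inner_self_eq_ofReal, sum_inner, Complex.ofReal_sum]
    refine Finset.sum_congr rfl fun a _ => ?_
    rw [inner_smul_left, h1, ofReal_norm_sq]
    split_ifs <;> simp
  simp only [h1]
  exact (Complex.ofReal_injective h2).symm

theorem PartialOrthonormal.eq_zero (hΦ : PartialOrthonormal Φ e) {a : ι} (ha : ¬ e a) :
    Φ a = 0 := by
  have := hΦ a a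
  rw [if_pos rfl, if_neg ha] at this
  exact inner_self_eq_zero.1 this

theorem PartialOrthonormal.norm_le_one (hΦ : PartialOrthonormal Φ e) (a : ι) : ‖Φ a‖ ≤ 1 := by
  have h := hΦ a a
  rw [if_pos rfl, inner_self_eq_ofReal] at h
  by_cases ha : e a
  · rw [if_pos ha] at h
    have h' : ‖Φ a‖ ^ 2 = 1 := by exact_mod_cast h
    exact (sq_le_one_iff₀ (norm_nonneg _)).1 h'.le
  · simp [hΦ.eq_zero ha]

/-- Bessel's inequality for the nonzero members; the others contribute nothing. -/
theorem PartialOrthonormal.sum_sq_inner_le [Fintype ι] (hΦ : PartialOrthonormal Φ e) (h : H) :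
    ∑ a, ‖⟪Φ a, h⟫_ℂ‖ ^ 2 ≤ ‖h‖ ^ 2 := by
  have hon : Orthonormal ℂ fun a : {a // e a} => Φ a := by
    rw [orthonormal_iff_ite]
    intro a b
    rw [hΦ, if_pos a.2]
    simp [Subtype.ext_iff]
  refine le_trans (le_of_eq ?_) (hon.sum_inner_products_le h (s := Finset.univ))
  rw [← Finset.sum_subtype (Finset.univ.filter e) (by simp) fun a => ‖⟪Φ a, h⟫_ℂ‖ ^ 2]
  refine (Finset.sum_filter_of_ne fun a _ ha => ?_).symm
  contrapose! ha
  simp [hΦ.eq_zero ha]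

end PartialOrthonormal

/-! ### Diagonalized Gram matrices -/

/-- With a threshold `p` separating the first `n` values from the rest, each product `(lam a - p) *
(c a - 1)` for `a < n`, and `(lam a - p) * c a` otherwise, is at most zero. Summing leaves `p * (∑ c
- n)`, which is at most zero as well. -/
theorem sum_mul_le_of_antitone {m n : ℕ} (hn : n ≤ m) {lam c : Fin m → ℝ}
    (hlam : Antitone lam) (h0 : ∀ a, 0 ≤ lam a) (hc0 : ∀ a, 0 ≤ c a) (hc1 : ∀ a, c a ≤ 1)
    (hc : ∑ a, c a ≤ n) : ∑ a, lam a * c a ≤ ∑ a : Fin m with a.val < n, lam a := by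
  obtain ⟨p, hp0, hp1, hp2⟩ : ∃ p : ℝ, 0 ≤ p ∧ (∀ a : Fin m, a.val < n → p ≤ lam a) ∧
      ∀ a : Fin m, n ≤ a.val → lam a ≤ p := by
    rcases hn.eq_or_lt with h | h
    · exact ⟨0, le_rfl, fun a _ => h0 a, fun a ha => by omega⟩
    · exact ⟨lam ⟨n, h⟩, h0 _, fun a ha => hlam (Fin.le_def.2 ha.le), fun a ha => hlam ha⟩
  have hcard : ∑ a : Fin m, (if a.val < n then (1 : ℝ) else 0) = n := by
    rw [Finset.sum_boole, Fin.card_filter_val_lt, min_eq_right hn]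
  rw [Finset.sum_filter]
  calc ∑ a, lam a * c a
      ≤ ∑ a : Fin m, ((if a.val < n then lam a else 0) +
          p * (c a - if a.val < n then (1 : ℝ) else 0)) := by
        refine Finset.sum_le_sum fun a _ => ?_
        split_ifs with h
        · nlinarith [hp1 a h, hc1 a]
        · nlinarith [hp2 a (not_lt.1 h), hc0 a]
    _ ≤ ∑ a : Fin m, (if a.val < n then lam a else 0) := by
        rw [Finset.sum_add_distrib, ← Finset.mul_sum, Finset.sum_sub_distrib, hcard]
        nlinarith

section Gram

open scoped InnerProductSpace

variable {H : Type*} [NormedAddCommGroup H] [InnerProductSpace ℂ H] {m : ℕ}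

/-- The rows of `y` are orthonormal left eigenvectors, with the eigenvalues `lam` in decreasing
order, of the Gram matrix with the entries `⟪F j, F i⟫`. -/
structure DiagonalizesGram (F : Fin m → H) (y : Fin m → Fin m → ℂ) (lam : Fin m → ℝ) : Prop where
  orthonormal : ∀ a b, ∑ j, y a j * star (y b j) = if a = b then 1 else 0
  eigen : ∀ a j, ∑ i, y a i * ⟪F j, F i⟫_ℂ = lam a * y a j
  antitone : Antitone lam

namespace DiagonalizesGram

variable {F : Fin m → H} {y : Fin m → Fin m → ℂ} {lam : Fin m → ℝ}

/-- The factor by which the combination of the vectors with an eigenvector is normalized. -/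
noncomputable def normalizer (t : ℝ) : ℝ := if t = 0 then 0 else t ^ (-(1 / 2) : ℝ)

theorem orthonormal_cols (h : DiagonalizesGram F y lam) (i j : Fin m) :
    ∑ a, star (y a i) * y a j = if i = j then 1 else 0 := by
  have h1 : Matrix.of y * (Matrix.of y).conjTranspose = 1 := by
    ext a b
    simp only [Matrix.mul_apply, Matrix.of_apply, Matrix.conjTranspose_apply, h.orthonormal,
      Matrix.one_apply]
  have h2 : ((Matrix.of y).conjTranspose * Matrix.of y) i j = (1 : Matrix _ _ ℂ) i j := by
    rw [mul_eq_one_comm.1 h1]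
  simpa only [Matrix.mul_apply, Matrix.of_apply, Matrix.conjTranspose_apply,
    Matrix.one_apply] using h2

theorem sum_norm_sq_row (h : DiagonalizesGram F y lam) (a : Fin m) : ∑ j, ‖y a j‖ ^ 2 = 1 := by
  have := h.orthonormal a a
  simp only [if_true, RCLike.star_def, RCLike.mul_conj] at this
  rw [← Complex.ofReal_inj]
  push_cast
  exact this

theorem inner_combination (h : DiagonalizesGram F y lam) (j a : Fin m) :
    ⟪F j, ∑ i, y a i • F i⟫_ℂ = lam a * y a j := by
  simp only [inner_sum, inner_smul_right, h.eigen]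

theorem inner_combinations (h : DiagonalizesGram F y lam) (a b : Fin m) :
    ⟪∑ i, y a i • F i, ∑ i, y b i • F i⟫_ℂ = if a = b then (lam a : ℂ) else 0 := by
  rw [sum_inner]
  simp only [inner_smul_left, h.inner_combination]
  have : ∀ j, starRingEnd ℂ (y a j) * (lam b * y b j) = lam b * (y b j * star (y a j)) :=
    fun j => by rw [RCLike.star_def]; ring
  simp only [this, ← Finset.mul_sum, h.orthonormal]
  split_ifs with h1 h2 h2
  · simp [h1]
  · exact absurd h1.symm h2
  · exact absurd h2.symm h1
  · simp

theorem nonneg (h : DiagonalizesGram F y lam) (a : Fin m) : 0 ≤ lam a := by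
  have h1 := h.inner_combinations a a
  rw [if_pos rfl, inner_self_eq_ofReal] at h1
  have h2 : ‖∑ i, y a i • F i‖ ^ 2 = lam a := by exact_mod_cast h1
  exact h2 ▸ sq_nonneg _

theorem normalizer_sq_mul {t : ℝ} (ht : 0 ≤ t) :
    normalizer t ^ 2 * t = if t = 0 then 0 else 1 := by
  unfold normalizer
  split_ifs with h
  · simp [h]
  · rw [← Real.rpow_natCast, ← Real.rpow_mul ht]
    norm_num
    rw [Real.rpow_neg_one, inv_mul_cancel₀ h]

theorem partialOrthonormal (h : DiagonalizesGram F y lam) :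
    PartialOrthonormal (fun a => (normalizer (lam a) : ℂ) • ∑ i, y a i • F i)
      (fun a => lam a ≠ 0) := fun a b => by
  rw [inner_smul_left, inner_smul_right, h.inner_combinations, Complex.conj_ofReal]
  by_cases hab : a = b
  · subst hab
    have := normalizer_sq_mul (h.nonneg a)
    rw [if_pos rfl, if_pos rfl, ← mul_assoc, ← sq, ← Complex.ofReal_pow, ← Complex.ofReal_mul, this]
    split_ifs <;> simp_all
  · simp [hab]

theorem norm_sq_inner_eq (h : DiagonalizesGram F y lam) (a j : Fin m) :
    ‖⟪(normalizer (lam a) : ℂ) • ∑ i, y a i • F i, F j⟫_ℂ‖ ^ 2 = lam a * ‖y a j‖ ^ 2 := by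
  rw [norm_inner_symm, inner_smul_right, h.inner_combination, ← mul_assoc, norm_mul, mul_pow,
    ← Complex.ofReal_mul, Complex.norm_real, Real.norm_eq_abs, sq_abs, mul_pow, sq (lam a),
    ← mul_assoc, normalizer_sq_mul (h.nonneg a)]
  split_ifs with h0 <;> simp [h0]

theorem sum_norm_sq_inner_eq (h : DiagonalizesGram F y lam) (a : Fin m) :
    ∑ j, ‖⟪(normalizer (lam a) : ℂ) • ∑ i, y a i • F i, F j⟫_ℂ‖ ^ 2 = lam a := by
  simp only [h.norm_sq_inner_eq, ← Finset.mul_sum, h.sum_norm_sq_row, mul_one]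

theorem inner_eq (h : DiagonalizesGram F y lam) (i j : Fin m) :
    ⟪F j, F i⟫_ℂ = ∑ a, lam a * (y a j * star (y a i)) := by
  calc ⟪F j, F i⟫_ℂ = ∑ k, (∑ a, star (y a i) * y a k) * ⟪F j, F k⟫_ℂ := by
        simp only [h.orthonormal_cols, ite_mul, one_mul, zero_mul, Finset.sum_ite_eq,
          Finset.mem_univ, if_true]
    _ = ∑ a, star (y a i) * ∑ k, y a k * ⟪F j, F k⟫_ℂ := by
        simp only [Finset.sum_mul, Finset.mul_sum, mul_assoc]
        exact Finset.sum_comm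
    _ = _ := Finset.sum_congr rfl fun a _ => by rw [h.eigen]; ring

theorem sum_norm_sq (h : DiagonalizesGram F y lam) : ∑ j, ‖F j‖ ^ 2 = ∑ a, lam a := by
  have h1 : ∀ j, ‖F j‖ ^ 2 = ∑ a, lam a * ‖y a j‖ ^ 2 := fun j => by
    rw [← Complex.ofReal_inj]
    have := h.inner_eq j j
    rw [inner_self_eq_ofReal] at this
    rw [this, Complex.ofReal_sum]
    refine Finset.sum_congr rfl fun a _ => ?_
    rw [Complex.ofReal_mul, ofReal_norm_sq, mul_comm (star _)]
  simp only [h1]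
  rw [Finset.sum_comm]
  simp only [← Finset.mul_sum, h.sum_norm_sq_row, mul_one]

/-- The unitary `y` preserves the sum of squares, turning the `F i` into their eigenvector
combinations. The factor `lam a` undoes the normalization; where it vanishes, so does the
combination. -/
theorem sum_norm_sq_inner_left (h : DiagonalizesGram F y lam) (b : H) :
    ∑ i, ‖⟪b, F i⟫_ℂ‖ ^ 2 =
      ∑ a, lam a * ‖⟪(normalizer (lam a) : ℂ) • ∑ i, y a i • F i, b⟫_ℂ‖ ^ 2 := by
  have h1 : ∀ a, lam a * ‖⟪(normalizer (lam a) : ℂ) • ∑ i, y a i • F i, b⟫_ℂ‖ ^ 2 =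
      ‖⟪b, ∑ i, y a i • F i⟫_ℂ‖ ^ 2 := fun a => by
    rw [norm_inner_symm, inner_smul_right, norm_mul, mul_pow, Complex.norm_real,
      Real.norm_eq_abs, sq_abs, ← mul_assoc, mul_comm (lam a), normalizer_sq_mul (h.nonneg a)]
    split_ifs with h0
    · have := h.inner_combinations a a
      rw [if_pos rfl, h0, Complex.ofReal_zero] at this
      rw [inner_self_eq_zero.1 this]
      simp
    · rw [one_mul]
  simp only [h1, inner_sum, inner_smul_right]
  rw [← Complex.ofReal_inj]
  simp only [Complex.ofReal_sum, ofReal_norm_sq, star_sum, star_mul', Finset.sum_mul,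
    Finset.mul_sum]
  have h3 : ∀ i j, ∑ a, star (y a i) * star ⟪b, F i⟫_ℂ * (y a j * ⟪b, F j⟫_ℂ) =
      if i = j then star ⟪b, F i⟫_ℂ * ⟪b, F j⟫_ℂ else 0 := fun i j => by
    trans (∑ a, star (y a i) * y a j) * (star ⟪b, F i⟫_ℂ * ⟪b, F j⟫_ℂ)
    · rw [Finset.sum_mul]
      exact Finset.sum_congr rfl fun a _ => by ring
    · rw [h.orthonormal_cols]; split_ifs <;> simp
  symm
  rw [Finset.sum_comm]
  refine Finset.sum_congr rfl fun i _ => ?_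
  rw [Finset.sum_comm]
  simp only [h3]
  simp

/-- The Eckart–Young lower bound for the approximation by a space of dimension at most `n`. -/
theorem sum_tail_le (h : DiagonalizesGram F y lam) {n : ℕ} (hn : n ≤ m) (W : Submodule ℂ H)
    [FiniteDimensional ℂ W] (hW : Module.finrank ℂ W ≤ n) {g : Fin m → H} (hg : ∀ i, g i ∈ W) :
    ∑ a : Fin m with n ≤ a.val, lam a ≤ ∑ i, ‖F i - g i‖ ^ 2 := by
  let b := stdOrthonormalBasis ℂ W
  set Φ : Fin m → H := fun a => (normalizer (lam a) : ℂ) • ∑ i, y a i • F i with hΦdef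
  have hΦ : PartialOrthonormal Φ _ := h.partialOrthonormal
  have hproj : ∀ x : H, ‖W.starProjection x‖ ^ 2 = ∑ l, ‖⟪(b l : H), x⟫_ℂ‖ ^ 2 := fun x => by
    rw [Submodule.starProjection_apply, Submodule.norm_coe, ← b.sum_sq_norm_inner_right]
    simp
  -- Pythagoras, and the projection is the best approximation from `W`.
  have h1 : ∀ i, ‖F i‖ ^ 2 - ‖W.starProjection (F i)‖ ^ 2 ≤ ‖F i - g i‖ ^ 2 := fun i => by
    have h1 := W.norm_sq_eq_add_norm_sq_starProjection (F i)
    have h2 : ‖Wᗮ.starProjection (F i)‖ ≤ ‖F i - g i‖ := by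
      rw [Submodule.starProjection_orthogonal', sub_apply, one_apply_eq_self,
        Submodule.starProjection_minimal]
      exact ciInf_le ⟨0, by rintro _ ⟨x, rfl⟩; exact norm_nonneg _⟩ (⟨g i, hg i⟩ : W)
    have h3 := pow_le_pow_left₀ (norm_nonneg _) h2 2
    linarith
  have h2 : ∑ i, ‖W.starProjection (F i)‖ ^ 2 = ∑ a, lam a * ∑ l, ‖⟪(b l : H), Φ a⟫_ℂ‖ ^ 2 := by
    simp only [hproj]
    rw [Finset.sum_comm]
    simp only [h.sum_norm_sq_inner_left, Finset.mul_sum]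
    rw [Finset.sum_comm]
    simp only [norm_inner_symm _ (b _ : H), hΦdef]
  -- The weights are `‖P_W Φ_a‖ ^ 2`: each is at most one, and Bessel applied to every unit vector
  -- `b l` bounds their sum by the dimension of `W`.
  have h3 : ∑ a, lam a * ∑ l, ‖⟪(b l : H), Φ a⟫_ℂ‖ ^ 2 ≤ ∑ a : Fin m with a.val < n, lam a := by
    refine sum_mul_le_of_antitone hn h.antitone h.nonneg (fun a => by positivity) (fun a => ?_) ?_
    · rw [← hproj]
      have := (W.norm_starProjection_apply_le (Φ a)).trans (hΦ.norm_le_one a)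
      exact pow_le_one₀ (norm_nonneg _) this
    · rw [Finset.sum_comm]
      calc ∑ l, ∑ a, ‖⟪(b l : H), Φ a⟫_ℂ‖ ^ 2 ≤ ∑ l, (1 : ℝ) := by
            refine Finset.sum_le_sum fun l _ => ?_
            simp only [norm_inner_symm (b l : H)]
            refine (hΦ.sum_sq_inner_le (b l : H)).trans_eq ?_
            have := b.orthonormal.1 l
            rw [Submodule.coe_norm] at this
            rw [this, one_pow]
        _ ≤ n := by simpa using hW
  have h4 := Finset.sum_filter_add_sum_filter_not Finset.univ (fun a : Fin m => a.val < n) lam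
  simp only [not_lt] at h4
  have h5 := Finset.sum_le_sum fun i (_ : i ∈ Finset.univ) => h1 i
  rw [Finset.sum_sub_distrib, h.sum_norm_sq, h2] at h5
  linarith

end DiagonalizesGram

end Gram

/-! ### Periodization over the unit cube -/

section Periodization

open scoped ENNReal

variable {d : ℕ}

/-- The half-open cube `(0,1]^d`. -/
def halfOpenCube (d : ℕ) : Set (Rd d) := {ω | ∀ i, ω i ∈ Set.Ioc (0 : ℝ) 1}

/-- Lebesgue measure on the unit cube. -/
noncomputable abbrev cubeMeasure (d : ℕ) : Measure (Rd d) := volume.restrict (unitCube d)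

theorem halfOpenCube_eq_preimage :
    halfOpenCube d = (WithLp.ofLp : Rd d → Fin d → ℝ) ⁻¹' Set.univ.pi fun _ => Set.Ioc 0 1 := by
  ext; simp [halfOpenCube]

theorem measurableSet_halfOpenCube : MeasurableSet (halfOpenCube d) := by
  rw [halfOpenCube_eq_preimage]
  exact (PiLp.volume_preserving_ofLp (Fin d)).measurable
    (MeasurableSet.univ_pi fun _ => measurableSet_Ioc)

/-- Only the half-open cube has disjoint integer translates; the closed cube of the statement
differs from it by a null set. -/
theorem halfOpenCube_ae_eq : halfOpenCube d =ᵐ[volume] unitCube d := by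
  have h : unitCube d = (WithLp.ofLp : Rd d → Fin d → ℝ) ⁻¹' Set.Icc 0 1 := by
    ext; simp [unitCube, Pi.le_def, forall_and]
  rw [h, halfOpenCube_eq_preimage]
  exact (PiLp.volume_preserving_ofLp (Fin d)).quasiMeasurePreserving.preimage_ae_eq
    (Measure.univ_pi_Ioc_ae_eq_Icc (f := 0) (g := 1))

theorem restrict_halfOpenCube : volume.restrict (halfOpenCube d) = volume.restrict (unitCube d) :=
  Measure.restrict_congr_set halfOpenCube_ae_eq

theorem intVec_add (k l : Fin d → ℤ) : intVec (k + l) = intVec k + intVec l := by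
  ext i; simp [intVec]

/-- The translates of the half-open cube. -/
def cubeTranslate (k : Fin d → ℤ) : Set (Rd d) := (fun ω => ω - intVec k) ⁻¹' halfOpenCube d

theorem mem_cubeTranslate {k : Fin d → ℤ} {ω : Rd d} :
    ω ∈ cubeTranslate k ↔ ∀ i, ⌈ω i⌉ = k i + 1 := by
  simp only [cubeTranslate, halfOpenCube, intVec, Set.mem_preimage, Set.mem_ofPred_eq,
    PiLp.sub_apply, Set.mem_Ioc, Int.ceil_eq_iff]
  refine forall_congr' fun i => ?_
  push_cast
  constructor <;> rintro ⟨h1, h2⟩ <;> constructor <;> linarith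

theorem iUnion_cubeTranslate : ⋃ k : Fin d → ℤ, cubeTranslate k = Set.univ :=
  Set.eq_univ_of_forall fun ω => Set.mem_iUnion.2
    -- The cubes are open on the left, hence the ceiling minus one instead of the floor.
    ⟨fun i => ⌈ω i⌉ - 1, mem_cubeTranslate.2 fun i => by ring⟩

theorem pairwise_disjoint_cubeTranslate :
    Pairwise (Function.onFun Disjoint (cubeTranslate (d := d))) := fun k l hkl =>
  Set.disjoint_left.2 fun ω hk hl => hkl <| funext fun i => by
    have h1 := mem_cubeTranslate.1 hk i
    have h2 := mem_cubeTranslate.1 hl i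
    omega

theorem measurableSet_cubeTranslate (k : Fin d → ℤ) : MeasurableSet (cubeTranslate k) :=
  (measurable_id.sub_const _) measurableSet_halfOpenCube

theorem preimage_add_cubeTranslate (k : Fin d → ℤ) :
    (fun ω : Rd d => ω + intVec k) ⁻¹' cubeTranslate k = halfOpenCube d := by
  ext; simp [cubeTranslate]

theorem lintegral_cube_tsum {h : Rd d → ℝ≥0∞} (hh : Measurable h) :
    ∫⁻ ω in unitCube d, ∑' k : Fin d → ℤ, h (ω + intVec k) = ∫⁻ ω, h ω := by
  have hm : ∀ k : Fin d → ℤ, Measurable fun ω => h (ω + intVec k) :=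
    fun k => hh.comp (measurable_id.add_const _)
  rw [lintegral_tsum fun k => (hm k).aemeasurable,
    ← setLIntegral_univ h, ← iUnion_cubeTranslate,
    lintegral_iUnion measurableSet_cubeTranslate pairwise_disjoint_cubeTranslate]
  refine tsum_congr fun k => ?_
  rw [← restrict_halfOpenCube, ← preimage_add_cubeTranslate k]
  exact (measurePreserving_add_right volume (intVec k)).setLIntegral_comp_preimage
    (measurableSet_cubeTranslate k) hh

variable {E : Type*} [NormedAddCommGroup E] [MeasurableSpace E] [BorelSpace E]

theorem lintegral_cube_tsum_enorm_ne_top {h : Rd d → E} (hm : Measurable h) (hh : Integrable h) :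
    ∫⁻ ω in unitCube d, ∑' k : Fin d → ℤ, ‖h (ω + intVec k)‖ₑ ≠ ∞ := by
  rw [lintegral_cube_tsum hm.enorm]
  exact hh.2.ne

theorem ae_summable_translates {h : Rd d → E} (hm : Measurable h) (hh : Integrable h) :
    ∀ᵐ ω ∂cubeMeasure d, Summable fun k : Fin d → ℤ => ‖h (ω + intVec k)‖ := by
  have hm' : Measurable fun ω : Rd d => ∑' k : Fin d → ℤ, ‖h (ω + intVec k)‖ₑ :=
    Measurable.tsum fun k => (hm.comp (measurable_id.add_const _)).enorm
  filter_upwards [ae_lt_top hm' (lintegral_cube_tsum_enorm_ne_top hm hh)] with ω hω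
  have := ENNReal.summable_toReal hω.ne
  simpa using this

/-- The sum takes the value `0` where it diverges, so it is measurable on the whole space and not
only almost everywhere. -/
theorem measurable_tsum_translates [CompleteSpace E] [SecondCountableTopology E]
    {h : Rd d → E} (hm : Measurable h) :
    Measurable fun ω : Rd d => ∑' k : Fin d → ℤ, h (ω + intVec k) :=
  Measurable.tsum fun _ => hm.comp (measurable_id.add_const _)

theorem integrable_cube_tsum [CompleteSpace E] [SecondCountableTopology E]
    {h : Rd d → E} (hm : Measurable h) (hh : Integrable h) :
    Integrable (fun ω => ∑' k : Fin d → ℤ, h (ω + intVec k)) (cubeMeasure d) := by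
  refine ⟨(measurable_tsum_translates hm).aestronglyMeasurable, ?_⟩
  refine lt_of_le_of_lt (lintegral_mono fun ω => ?_)
    (lintegral_cube_tsum_enorm_ne_top hm hh).lt_top
  exact enorm_tsum_le_tsum_enorm

theorem integral_cube_tsum [NormedSpace ℝ E] [SecondCountableTopology E]
    {h : Rd d → E} (hm : Measurable h) (hh : Integrable h) :
    ∫ ω in unitCube d, ∑' k : Fin d → ℤ, h (ω + intVec k) = ∫ ω, h ω := by
  have hmk : ∀ k : Fin d → ℤ, Measurable fun ω => h (ω + intVec k) :=
    fun k => hm.comp (measurable_id.add_const _)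
  rw [integral_tsum fun k => (hmk k).aestronglyMeasurable]
  · rw [← setIntegral_univ (f := h), ← iUnion_cubeTranslate,
      integral_iUnion measurableSet_cubeTranslate pairwise_disjoint_cubeTranslate
        hh.integrableOn]
    refine tsum_congr fun k => ?_
    rw [← restrict_halfOpenCube, ← preimage_add_cubeTranslate k]
    exact (measurePreserving_add_right volume (intVec k)).setIntegral_preimage_emb
      (measurableEmbedding_addRight _) h _
  · rw [← lintegral_tsum fun k => (hmk k).enorm.aemeasurable]
    exact lintegral_cube_tsum_enorm_ne_top hm hh

theorem ae_forall_translate {p : Rd d → Prop} (h : ∀ᵐ ω, p ω) :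
    ∀ᵐ ω, ∀ k : Fin d → ℤ, p (ω + intVec k) :=
  ae_all_iff.2 fun k =>
    (measurePreserving_add_right volume (intVec k)).quasiMeasurePreserving.ae h

end Periodization

/-! ### Fibers -/

section Fiber

open scoped ENNReal InnerProductSpace

variable {d : ℕ}

/-- The Hilbert space `ℓ²(ℤ^d)`. -/
abbrev Ell2 (d : ℕ) : Type := lp (fun _ : Fin d → ℤ => ℂ) 2

/-- The values of `u` on `ω + ℤ^d` are square summable. -/
def HasFiber (u : Rd d → ℂ) (ω : Rd d) : Prop :=
  Memℓp (fun k : Fin d → ℤ => u (ω + intVec k)) 2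

open Classical in
/-- The sequence of the values of `u` on `ω + ℤ^d`, or `0` if it is not square summable. -/
noncomputable def fiber (u : Rd d → ℂ) (ω : Rd d) : Ell2 d :=
  if h : HasFiber u ω then ⟨fun k => u (ω + intVec k), h⟩ else 0

variable {u v : Rd d → ℂ} {ω : Rd d}

theorem HasFiber.coe_fiber (h : HasFiber u ω) (k : Fin d → ℤ) :
    (fiber u ω) k = u (ω + intVec k) := by
  rw [fiber, dif_pos h]

theorem hasFiber_iff : HasFiber u ω ↔ Summable fun k : Fin d → ℤ => ‖u (ω + intVec k)‖ ^ 2 := by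
  rw [HasFiber, memℓp_gen_iff (by simp)]
  simp

theorem HasFiber.add (hu : HasFiber u ω) (hv : HasFiber v ω) :
    HasFiber (fun x => u x + v x) ω := Memℓp.add hu hv

theorem HasFiber.const_mul (hu : HasFiber u ω) (c : ℂ) :
    HasFiber (fun x => c * u x) ω := Memℓp.const_smul hu c

theorem HasFiber.periodic_mul (hu : HasFiber u ω) {c : Rd d → ℂ}
    (hc : ∀ k : Fin d → ℤ, c (ω + intVec k) = c ω) : HasFiber (fun x => c x * u x) ω := by
  have := hu.const_mul (c ω)
  rw [HasFiber] at this ⊢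
  simpa only [hc] using this

theorem HasFiber.sum {ι : Type*} {s : Finset ι} {u : ι → Rd d → ℂ}
    (hu : ∀ i ∈ s, HasFiber (u i) ω) : HasFiber (fun x => ∑ i ∈ s, u i x) ω :=
  Memℓp.finsetSum s hu

theorem HasFiber.fiber_add (hu : HasFiber u ω) (hv : HasFiber v ω) :
    fiber (fun x => u x + v x) ω = fiber u ω + fiber v ω := by
  ext k
  rw [(hu.add hv).coe_fiber, lp.coeFn_add, Pi.add_apply, hu.coe_fiber, hv.coe_fiber]

/-- A periodic factor is constant along `ω + ℤ^d`. Characters, eigenvectors and normalizing factors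
all enter the fibers in this way. -/
theorem HasFiber.fiber_periodic_mul (hu : HasFiber u ω) {c : Rd d → ℂ}
    (hc : ∀ k : Fin d → ℤ, c (ω + intVec k) = c ω) :
    fiber (fun x => c x * u x) ω = c ω • fiber u ω := by
  ext k
  rw [(hu.periodic_mul hc).coe_fiber, lp.coeFn_smul, Pi.smul_apply, hu.coe_fiber, hc, smul_eq_mul]

theorem HasFiber.fiber_sum {ι : Type*} {s : Finset ι} {u : ι → Rd d → ℂ}
    (hu : ∀ i ∈ s, HasFiber (u i) ω) :
    fiber (fun x => ∑ i ∈ s, u i x) ω = ∑ i ∈ s, fiber (u i) ω := by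
  ext k
  rw [(HasFiber.sum hu).coe_fiber, lp.coeFn_sum, Finset.sum_apply]
  exact Finset.sum_congr rfl fun i hi => ((hu i hi).coe_fiber k).symm

theorem HasFiber.inner_fiber (hu : HasFiber u ω) (hv : HasFiber v ω) :
    ⟪fiber u ω, fiber v ω⟫_ℂ =
      ∑' k : Fin d → ℤ, v (ω + intVec k) * star (u (ω + intVec k)) := by
  rw [lp.inner_eq_tsum]
  refine tsum_congr fun k => ?_
  rw [hu.coe_fiber, hv.coe_fiber]
  rfl

theorem HasFiber.norm_fiber_sq (hu : HasFiber u ω) :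
    ‖fiber u ω‖ ^ 2 = ∑' k : Fin d → ℤ, ‖u (ω + intVec k)‖ ^ 2 := by
  have := lp.norm_rpow_eq_tsum (p := 2) (by simp) (fiber u ω)
  simp only [ENNReal.toReal_ofNat, Real.rpow_ofNat] at this
  rw [this]
  exact tsum_congr fun k => by rw [hu.coe_fiber]

/-- The exceptional null set has only countably many integer translates, so almost every fiber
avoids it entirely. -/
theorem fiber_congr (h : u =ᵐ[volume] v) : ∀ᵐ ω ∂cubeMeasure d, fiber u ω = fiber v ω := by
  filter_upwards [ae_restrict_of_ae (ae_forall_translate h)] with ω hω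
  have h' : (fun k : Fin d → ℤ => u (ω + intVec k)) = fun k => v (ω + intVec k) := funext hω
  have h'' : HasFiber u ω ↔ HasFiber v ω := by rw [HasFiber, HasFiber, h']
  by_cases hu : HasFiber u ω
  · ext k
    rw [hu.coe_fiber, (h''.1 hu).coe_fiber, hω]
  · rw [fiber, fiber, dif_neg hu, dif_neg (mt h''.2 hu)]

theorem _root_.MeasureTheory.MemLp.integrable_norm_sq (hu : MemLp u 2) :
    Integrable fun ω => ‖u ω‖ ^ 2 :=
  (memLp_two_iff_integrable_sq_norm hu.1).1 hu

theorem ae_hasFiber (hm : Measurable u) (hu : MemLp u 2) :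
    ∀ᵐ ω ∂cubeMeasure d, HasFiber u ω := by
  filter_upwards [ae_summable_translates (hm.norm.pow_const 2) hu.integrable_norm_sq] with ω hω
  rw [hasFiber_iff]
  simpa using hω

theorem integrable_inner_fiber (hum : Measurable u) (hu : MemLp u 2) (hvm : Measurable v)
    (hv : MemLp v 2) : Integrable (fun ω => ⟪fiber u ω, fiber v ω⟫_ℂ) (cubeMeasure d) := by
  refine (integrable_cube_tsum (hvm.mul (continuous_star.measurable.comp hum))
    (hv.integrable_mul hu.star)).congr ?_
  filter_upwards [ae_hasFiber hum hu, ae_hasFiber hvm hv] with ω h1 h2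
  exact (h1.inner_fiber h2).symm

theorem integral_inner_fiber (hum : Measurable u) (hu : MemLp u 2) (hvm : Measurable v)
    (hv : MemLp v 2) :
    ∫ ω in unitCube d, ⟪fiber u ω, fiber v ω⟫_ℂ = ∫ ω, ⟪u ω, v ω⟫_ℂ := by
  refine Eq.trans ?_ (integral_cube_tsum (hvm.mul (continuous_star.measurable.comp hum))
    (hv.integrable_mul hu.star))
  refine integral_congr_ae ?_
  filter_upwards [ae_hasFiber hum hu, ae_hasFiber hvm hv] with ω h1 h2
  exact h1.inner_fiber h2

theorem integrable_norm_sq_fiber (hm : Measurable u) (hu : MemLp u 2) :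
    Integrable (fun ω => ‖fiber u ω‖ ^ 2) (cubeMeasure d) := by
  refine (integrable_cube_tsum (hm.norm.pow_const 2) hu.integrable_norm_sq).congr ?_
  filter_upwards [ae_hasFiber hm hu] with ω h
  exact h.norm_fiber_sq.symm

end Fiber

/-! ### Characters and translations -/

section Phase

open UnitAddTorus

variable {d : ℕ}

/-- The character `ω ↦ exp(-2πi ⟨k, ω⟩)`. -/
noncomputable def phase (k : Fin d → ℤ) (ω : Rd d) : ℂ :=
  mFourier (-k) fun i => (ω i : UnitAddCircle)

theorem phase_eq_prod (k : Fin d → ℤ) (ω : Rd d) :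
    phase k ω = ∏ i, Complex.exp (-(2 * Real.pi * Complex.I * k i * ω i)) := by
  simp only [phase, mFourier, ContinuousMap.coe_mk, fourier_coe_apply]
  refine Finset.prod_congr rfl fun i _ => ?_
  congr 1
  simp

theorem continuous_phase (k : Fin d → ℤ) : Continuous (phase k) := by
  simp only [funext (phase_eq_prod k)]
  fun_prop

theorem norm_phase (k : Fin d → ℤ) (ω : Rd d) : ‖phase k ω‖ = 1 := by
  rw [phase_eq_prod, norm_prod]
  refine Finset.prod_eq_one fun i _ => ?_
  have : -(2 * Real.pi * Complex.I * k i * ω i) =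
      ((-(2 * Real.pi * k i * ω i) : ℝ) : ℂ) * Complex.I := by push_cast; ring
  rw [this, Complex.norm_exp_ofReal_mul_I]

theorem phase_add_intVec (k l : Fin d → ℤ) (ω : Rd d) : phase k (ω + intVec l) = phase k ω := by
  simp only [phase]
  congr 1
  ext i
  simp [intVec]

theorem phase_eq_fourierChar (k : Fin d → ℤ) (ω : Rd d) :
    phase k ω = Real.fourierChar (-(inner ℝ (intVec k) ω)) := by
  rw [phase_eq_prod, ← Complex.exp_sum, Real.fourierChar_apply]
  congr 1
  rw [PiLp.inner_apply]
  simp only [intVec, RCLike.inner_apply, conj_trivial]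
  push_cast
  rw [← Finset.sum_neg_distrib, Finset.mul_sum, Finset.sum_mul]
  exact Finset.sum_congr rfl fun i _ => by ring

/-! ### The Fourier transform of a translate -/

theorem memLp_phase_mul (k : Fin d → ℤ) {u : Rd d → ℂ} (hu : MemLp u 2) :
    MemLp (fun ω => phase k ω * u ω) 2 :=
  hu.of_le ((continuous_phase k).aestronglyMeasurable.mul hu.1)
    (.of_forall fun ω => by rw [norm_mul, norm_phase, one_mul])

/-- Multiplication by the character `phase k` on `L²`. -/
noncomputable def modulate (k : Fin d → ℤ) (g : L2 d) : L2 d :=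
  (memLp_phase_mul k (Lp.memLp g)).toLp

theorem coeFn_modulate (k : Fin d → ℤ) (g : L2 d) :
    modulate k g =ᵐ[volume] fun ω => phase k ω * g ω :=
  MemLp.coeFn_toLp _

theorem continuous_modulate (k : Fin d → ℤ) : Continuous (modulate (d := d) k) := by
  refine Isometry.continuous fun g h => ?_
  rw [modulate, modulate, Lp.edist_toLp_toLp, Lp.edist_def]
  refine eLpNorm_congr_norm_ae (.of_forall fun ω => ?_)
  simp only [Pi.sub_apply, ← mul_sub, norm_mul, norm_phase, one_mul]

theorem fourier_translate (k : Fin d → ℤ) (φ : L2 d) :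
    𝓕 (translate k φ) = modulate k (𝓕 φ) := by
  -- Both sides are continuous in `φ`, so the identity need only be checked on Schwartz functions,
  -- where it is the classical shift rule for the Fourier integral.
  refine DenseRange.induction_on (p := fun φ : L2 d => 𝓕 (translate k φ) = modulate k (𝓕 φ))
    (SchwartzMap.denseRange_toLpCLM (F := ℂ) (μ := volume) (p := 2) ENNReal.ofNat_ne_top) φ ?_ ?_
  · refine isClosed_eq ?_ ?_
    · exact (Lp.fourierTransformₗᵢ (Rd d) ℂ).continuous.comp
        (Lp.isometry_compMeasurePreserving _).continuous
    · exact (continuous_modulate k).comp (Lp.fourierTransformₗᵢ (Rd d) ℂ).continuous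
  · intro f
    simp only [SchwartzMap.toLpCLM_apply]
    have h1 : translate k (f.toLp 2) = (f.compSubConstCLM ℂ (intVec k)).toLp 2 := rfl
    rw [h1, SchwartzMap.toLp_fourier_eq, SchwartzMap.toLp_fourier_eq]
    refine Lp.ext ?_
    filter_upwards [SchwartzMap.coeFn_toLp (𝓕 (f.compSubConstCLM ℂ (intVec k))) 2 volume,
      SchwartzMap.coeFn_toLp (𝓕 f) 2 volume,
      coeFn_modulate k ((𝓕 f : SchwartzMap (Rd d) ℂ).toLp 2)] with ω h2 h3 h4
    rw [h2, h4, h3, SchwartzMap.fourier_coe, SchwartzMap.fourier_coe, phase_eq_fourierChar]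
    have := congrFun (VectorFourier.fourierIntegral_comp_add_right Real.fourierChar
      (volume : Measure (Rd d)) (innerₗ (Rd d)) f (-intVec k)) ω
    simp only [map_neg, LinearMap.neg_apply, innerₗ_apply_apply] at this
    exact this

theorem coeFn_fourier_translate (k : Fin d → ℤ) (φ : L2 d) :
    (𝓕 (translate k φ) : L2 d) =ᵐ[volume] fun ω => phase k ω * (𝓕 φ : L2 d) ω := by
  rw [fourier_translate]
  exact coeFn_modulate k _

end Phase

/-! ### Parseval's identity on the unit cube -/

section Parseval

-- The circle carries normalized Haar measure, the one with respect to which the characters are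
-- orthonormal.
noncomputable local instance : MeasureSpace UnitAddCircle := ⟨AddCircle.haarAddCircle⟩

local instance : Measure.IsAddHaarMeasure (volume : Measure UnitAddCircle) :=
  inferInstanceAs (Measure.IsAddHaarMeasure AddCircle.haarAddCircle)

local instance : IsProbabilityMeasure (volume : Measure UnitAddCircle) :=
  inferInstanceAs (IsProbabilityMeasure AddCircle.haarAddCircle)

variable {d : ℕ}

/-- The representative in the half-open cube of a point of the torus. -/
noncomputable def torusRep (x : UnitAddTorus (Fin d)) : Rd d :=
  WithLp.toLp 2 fun i => (AddCircle.equivIoc 1 0 (x i) : ℝ)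

theorem torusRep_coe {ω : Fin d → ℝ} (h : ∀ i, ω i ∈ Set.Ioc (0 : ℝ) (0 + 1)) :
    torusRep (fun i => (ω i : UnitAddCircle)) = WithLp.toLp 2 ω := by
  unfold torusRep
  congr 1
  ext i
  exact congrArg Subtype.val (AddCircle.equivIoc_coe_eq (p := (1 : ℝ)) (a := 0) (h i))

theorem measurable_torusRep : Measurable (torusRep (d := d)) := by
  have h1 : Measurable fun x : UnitAddTorus (Fin d) => fun i =>
      (AddCircle.equivIoc 1 0 (x i) : ℝ) :=
    measurable_pi_lambda _ fun i => measurable_subtype_coe.comp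
      ((AddCircle.measurableEquivIoc 1 0).measurable.comp (measurable_pi_apply i))
  exact (PiLp.volume_preserving_toLp (Fin d)).measurable.comp h1

theorem integral_torus {E : Type*} [NormedAddCommGroup E] [NormedSpace ℝ E]
    (h : UnitAddTorus (Fin d) → E) :
    ∫ x, h x = ∫ ω in unitCube d, h fun i => (ω i : UnitAddCircle) := by
  rw [UnitAddTorus.integral_preimage h 0, ← restrict_halfOpenCube, halfOpenCube_eq_preimage]
  have hs : {x : Fin d → ℝ | ∀ i, x i ∈ Set.Ioc ((0 : Fin d → ℝ) i) ((0 : Fin d → ℝ) i + 1)} =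
      Set.univ.pi fun _ => Set.Ioc 0 1 := by ext; simp
  rw [hs]
  exact ((PiLp.volume_preserving_ofLp (Fin d)).setIntegral_preimage_emb
    (MeasurableEquiv.toLp 2 (Fin d → ℝ)).symm.measurableEmbedding
    (fun x => h fun i => (x i : UnitAddCircle)) _).symm

theorem lintegral_torus (h : UnitAddTorus (Fin d) → ENNReal) :
    ∫⁻ x, h x = ∫⁻ ω in unitCube d, h fun i => (ω i : UnitAddCircle) := by
  rw [UnitAddTorus.lintegral_preimage h 0, ← restrict_halfOpenCube, halfOpenCube_eq_preimage]
  have hs : {x : Fin d → ℝ | ∀ i, x i ∈ Set.Ioc ((0 : Fin d → ℝ) i) ((0 : Fin d → ℝ) i + 1)} =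
      Set.univ.pi fun _ => Set.Ioc 0 1 := by ext; simp
  rw [hs]
  exact ((PiLp.volume_preserving_ofLp (Fin d)).setLIntegral_comp_preimage_emb
    (MeasurableEquiv.toLp 2 (Fin d → ℝ)).symm.measurableEmbedding
    (fun x => h fun i => (x i : UnitAddCircle)) _).symm

theorem ae_torusRep_coe :
    ∀ᵐ ω ∂cubeMeasure d, torusRep (fun i => (ω i : UnitAddCircle)) = ω := by
  rw [cubeMeasure, ← restrict_halfOpenCube]
  filter_upwards [ae_restrict_mem measurableSet_halfOpenCube] with ω hω
  exact torusRep_coe (ω := ω.ofLp) fun i => by simpa using hω i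

/-- Parseval's identity for functions on the unit cube. -/
theorem hasSum_sq_phase_integral {c : Rd d → ℂ} (hm : Measurable c)
    (hc : MemLp c 2 (cubeMeasure d)) :
    HasSum (fun k : Fin d → ℤ => ‖∫ ω in unitCube d, phase k ω * c ω‖ ^ 2)
      (∫ ω in unitCube d, ‖c ω‖ ^ 2) := by
  -- The function on the cube is carried to the torus through representatives, and the integrals are
  -- carried back.
  have hcT : MemLp (fun x : UnitAddTorus (Fin d) => c (torusRep x)) 2 := by
    refine ⟨(hm.comp measurable_torusRep).aestronglyMeasurable, ?_⟩
    have h := hc.2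
    rw [eLpNorm_lt_top_iff_lintegral_rpow_enorm_lt_top (by simp) (by simp)] at h ⊢
    rw [lintegral_torus]
    refine lt_of_eq_of_lt (lintegral_congr_ae ?_) h
    filter_upwards [ae_torusRep_coe] with ω hω
    rw [hω]
  have key := UnitAddTorus.hasSum_sq_mFourierCoeff (hcT.toLp)
  have h1 : ∀ k, UnitAddTorus.mFourierCoeff (hcT.toLp) k =
      ∫ ω in unitCube d, phase k ω * c ω := fun k => by
    rw [UnitAddTorus.mFourierCoeff]
    have : ∫ t, UnitAddTorus.mFourier (-k) t • (hcT.toLp) t =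
        ∫ t, UnitAddTorus.mFourier (-k) t • c (torusRep t) := by
      refine integral_congr_ae ?_
      filter_upwards [hcT.coeFn_toLp] with t ht
      rw [ht]
    rw [this, integral_torus]
    refine integral_congr_ae ?_
    filter_upwards [ae_torusRep_coe] with ω hω
    rw [hω]
    rfl
  have h2 : ∫ t, ‖(hcT.toLp) t‖ ^ 2 = ∫ ω in unitCube d, ‖c ω‖ ^ 2 := by
    trans ∫ t : UnitAddTorus (Fin d), ‖c (torusRep t)‖ ^ 2
    · refine integral_congr_ae ?_
      filter_upwards [hcT.coeFn_toLp] with t ht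
      rw [ht]
    · rw [integral_torus]
      refine integral_congr_ae ?_
      filter_upwards [ae_torusRep_coe] with ω hω
      rw [hω]
  simpa only [h1, h2] using key

end Parseval

/-! ### Fibers of the Fourier transform and of shift-invariant spaces -/

section SpectralFiber

open scoped ENNReal InnerProductSpace

variable {d : ℕ}

/-- The fiber at `ω` of the Fourier transform of `g`. -/
noncomputable def spectralFiber (g : L2 d) (ω : Rd d) : Ell2 d := fiber (𝓕 g : L2 d) ω

theorem measurable_coeFn (g : L2 d) : Measurable g := (Lp.stronglyMeasurable g).measurable

theorem ae_hasFiber_fourier (g : L2 d) : ∀ᵐ ω ∂cubeMeasure d, HasFiber (𝓕 g : L2 d) ω :=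
  ae_hasFiber (measurable_coeFn _) (Lp.memLp _)

theorem spectralFiber_add (g h : L2 d) :
    ∀ᵐ ω ∂cubeMeasure d, spectralFiber (g + h) ω = spectralFiber g ω + spectralFiber h ω := by
  have h1 : (𝓕 (g + h) : L2 d) =ᵐ[volume] fun ω => (𝓕 g : L2 d) ω + (𝓕 h : L2 d) ω := by
    rw [FourierTransform.fourier_add]
    exact Lp.coeFn_add _ _
  filter_upwards [fiber_congr h1, ae_hasFiber_fourier g, ae_hasFiber_fourier h] with ω h2 h3 h4
  rw [spectralFiber, h2, h3.fiber_add h4]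
  rfl

theorem spectralFiber_sub (g h : L2 d) :
    ∀ᵐ ω ∂cubeMeasure d, spectralFiber (g - h) ω = spectralFiber g ω - spectralFiber h ω := by
  filter_upwards [spectralFiber_add (g - h) h] with ω hω
  rw [sub_add_cancel] at hω
  rw [hω, add_sub_cancel_right]

theorem spectralFiber_smul (c : ℂ) (g : L2 d) :
    ∀ᵐ ω ∂cubeMeasure d, spectralFiber (c • g) ω = c • spectralFiber g ω := by
  have h1 : (𝓕 (c • g) : L2 d) =ᵐ[volume] fun ω => c * (𝓕 g : L2 d) ω := by
    rw [FourierTransform.fourier_smul]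
    exact Lp.coeFn_smul _ _
  filter_upwards [fiber_congr h1, ae_hasFiber_fourier g] with ω h2 h3
  rw [spectralFiber, h2]
  exact h3.fiber_periodic_mul (c := fun _ => c) fun _ => rfl

theorem spectralFiber_zero : ∀ᵐ ω ∂cubeMeasure d, spectralFiber (0 : L2 d) ω = 0 := by
  filter_upwards [spectralFiber_smul 0 (0 : L2 d)] with ω hω
  rwa [zero_smul, zero_smul] at hω

theorem spectralFiber_translate (k : Fin d → ℤ) (g : L2 d) :
    ∀ᵐ ω ∂cubeMeasure d, spectralFiber (translate k g) ω = phase k ω • spectralFiber g ω := by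
  filter_upwards [fiber_congr (coeFn_fourier_translate k g), ae_hasFiber_fourier g] with ω h2 h3
  rw [spectralFiber, h2]
  exact h3.fiber_periodic_mul fun l => phase_add_intVec k l ω

theorem integrable_norm_sq_spectralFiber (g : L2 d) :
    Integrable (fun ω => ‖spectralFiber g ω‖ ^ 2) (cubeMeasure d) :=
  integrable_norm_sq_fiber (measurable_coeFn _) (Lp.memLp _)

theorem integrable_inner_spectralFiber (g h : L2 d) :
    Integrable (fun ω => ⟪spectralFiber g ω, spectralFiber h ω⟫_ℂ) (cubeMeasure d) :=
  integrable_inner_fiber (measurable_coeFn _) (Lp.memLp _) (measurable_coeFn _) (Lp.memLp _)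

theorem integral_inner_spectralFiber (g h : L2 d) :
    ∫ ω in unitCube d, ⟪spectralFiber g ω, spectralFiber h ω⟫_ℂ = ⟪g, h⟫_ℂ := by
  rw [← Lp.inner_fourier_eq, L2.inner_def]
  exact integral_inner_fiber (measurable_coeFn _) (Lp.memLp _) (measurable_coeFn _) (Lp.memLp _)

theorem integral_norm_sq_spectralFiber (g : L2 d) :
    ∫ ω in unitCube d, ‖spectralFiber g ω‖ ^ 2 = ‖g‖ ^ 2 := by
  rw [← Complex.ofReal_inj, ← inner_self_eq_ofReal, ← integral_inner_spectralFiber,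
    ← integral_complex_ofReal]
  simp only [inner_self_eq_ofReal]

theorem inner_translate (g φ : L2 d) (k : Fin d → ℤ) :
    ⟪g, translate k φ⟫_ℂ =
      ∫ ω in unitCube d, phase k ω * ⟪spectralFiber g ω, spectralFiber φ ω⟫_ℂ := by
  rw [← integral_inner_spectralFiber]
  refine integral_congr_ae ?_
  filter_upwards [spectralFiber_translate k φ] with ω hω
  rw [hω, inner_smul_right]

/-- The span of the fibers of a family of generators. -/
noncomputable def fiberSpan {s : ℕ} (ψ : Fin s → L2 d) (ω : Rd d) : Submodule ℂ (Ell2 d) :=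
  Submodule.span ℂ (Set.range fun j => spectralFiber (ψ j) ω)

instance {s : ℕ} (ψ : Fin s → L2 d) (ω : Rd d) : FiniteDimensional ℂ (fiberSpan ψ ω) :=
  FiniteDimensional.span_of_finite ℂ (Set.finite_range _)

theorem finrank_fiberSpan_le {s : ℕ} (ψ : Fin s → L2 d) (ω : Rd d) :
    Module.finrank ℂ (fiberSpan ψ ω) ≤ s :=
  (finrank_range_le_card (R := ℂ) fun j => spectralFiber (ψ j) ω).trans_eq (Fintype.card_fin s)

theorem spectralFiber_mem_of_mem_span {s : ℕ} (ψ : Fin s → L2 d) {g : L2 d}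
    (hg : g ∈ Submodule.span ℂ
      (Set.range fun p : Fin s × (Fin d → ℤ) => translate p.2 (ψ p.1))) :
    ∀ᵐ ω ∂cubeMeasure d, spectralFiber g ω ∈ fiberSpan ψ ω := by
  induction hg using Submodule.span_induction with
  | mem x hx =>
    obtain ⟨p, rfl⟩ := hx
    filter_upwards [spectralFiber_translate p.2 (ψ p.1)] with ω hω
    rw [hω]
    exact Submodule.smul_mem _ _ (Submodule.subset_span ⟨p.1, rfl⟩)
  | zero =>
    filter_upwards [spectralFiber_zero] with ω hω
    rw [hω]
    exact Submodule.zero_mem _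
  | add x y _ _ hx hy =>
    filter_upwards [spectralFiber_add x y, hx, hy] with ω h1 h2 h3
    rw [h1]
    exact Submodule.add_mem _ h2 h3
  | smul c x _ hx =>
    filter_upwards [spectralFiber_smul c x, hx] with ω h1 h2
    rw [h1]
    exact Submodule.smul_mem _ _ h2

/-- The fibers of a limit are almost everywhere limit points of the fibers of the sequence. -/
theorem ae_forall_exists_norm_spectralFiber_lt {g : L2 d} {u : ℕ → L2 d}
    (hu : Filter.Tendsto u Filter.atTop (nhds g)) :
    ∀ᵐ ω ∂cubeMeasure d, ∀ ε > 0, ∃ n, ‖spectralFiber (g - u n) ω‖ ^ 2 < ε := by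
  set I : ℕ → Rd d → ℝ≥0∞ := fun n ω => ENNReal.ofReal (‖spectralFiber (g - u n) ω‖ ^ 2) with hI
  have hIm : ∀ n, AEMeasurable (I n) (cubeMeasure d) := fun n =>
    (integrable_norm_sq_spectralFiber (g - u n)).aemeasurable.ennreal_ofReal
  have hIint : ∀ n, ∫⁻ ω, I n ω ∂cubeMeasure d = ENNReal.ofReal (‖g - u n‖ ^ 2) := fun n => by
    rw [← integral_norm_sq_spectralFiber, ofReal_integral_eq_lintegral_ofReal
      (integrable_norm_sq_spectralFiber _) (.of_forall fun ω => sq_nonneg _)]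
  have hlim : Filter.Tendsto (fun n => ENNReal.ofReal (‖g - u n‖ ^ 2)) Filter.atTop (nhds 0) := by
    have h1 : Filter.Tendsto (fun n => ‖g - u n‖ ^ 2) Filter.atTop (nhds 0) := by
      simpa using ((tendsto_const_nhds (x := g)).sub hu).norm.pow 2
    simpa using ENNReal.tendsto_ofReal h1
  -- The integral of the infimum is below every term of a null sequence. This replaces the passage
  -- to an almost everywhere convergent subsequence.
  have hzero : ∫⁻ ω, ⨅ n, I n ω ∂cubeMeasure d = 0 := by
    refine le_antisymm (ge_of_tendsto' hlim fun n => ?_) zero_le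
    rw [← hIint n]
    exact lintegral_mono fun ω => iInf_le _ n
  rw [lintegral_eq_zero_iff' (AEMeasurable.iInf hIm)] at hzero
  filter_upwards [hzero] with ω hω ε hε
  obtain ⟨n, hn⟩ := iInf_lt_iff.1 (hω.trans_lt (ENNReal.ofReal_pos.2 hε))
  exact ⟨n, (ENNReal.ofReal_lt_ofReal_iff hε).1 hn⟩

/-- Almost all fibers of the members of a shift-invariant space lie in the span of the fibers of
the generators. -/
theorem spectralFiber_mem_of_mem_siSpace {s : ℕ} (ψ : Fin s → L2 d) {g : L2 d}
    (hg : g ∈ siSpace ψ) : ∀ᵐ ω ∂cubeMeasure d, spectralFiber g ω ∈ fiberSpan ψ ω := by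
  have hg' : g ∈ closure (Submodule.span ℂ
      (Set.range fun p : Fin s × (Fin d → ℤ) => translate p.2 (ψ p.1)) : Set (L2 d)) := hg
  obtain ⟨u, hu, hlim⟩ := mem_closure_iff_seq_limit.1 hg'
  filter_upwards [ae_all_iff.2 fun n => spectralFiber_mem_of_mem_span ψ (hu n),
    ae_all_iff.2 fun n => spectralFiber_sub g (u n),
    ae_forall_exists_norm_spectralFiber_lt hlim] with ω h1 h2 h3
  -- Finite dimension makes the span closed, so limit points of fibers stay in it.
  have hcl : IsClosed (fiberSpan ψ ω : Set (Ell2 d)) := Submodule.closed_of_finiteDimensional _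
  rw [← SetLike.mem_coe, ← hcl.closure_eq, Metric.mem_closure_iff]
  intro ε hε
  obtain ⟨n, hn⟩ := h3 (ε ^ 2) (by positivity)
  refine ⟨_, h1 n, ?_⟩
  rw [dist_eq_norm, ← h2 n]
  exact lt_of_pow_lt_pow_left₀ 2 hε.le hn

theorem translate_mem_siSpace {s : ℕ} (ψ : Fin s → L2 d) (p : Fin s × (Fin d → ℤ)) :
    translate p.2 (ψ p.1) ∈ siSpace ψ :=
  subset_closure (Submodule.subset_span ⟨p, rfl⟩)

/-! ### Generators with partially orthonormal fibers -/

variable {n : ℕ} {φ : Fin n → L2 d} {e : Rd d → Fin n → Prop} [∀ ω, DecidablePred (e ω)]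

theorem memLp_inner_spectralFiber
    (hφ : ∀ᵐ ω ∂cubeMeasure d, PartialOrthonormal (fun i => spectralFiber (φ i) ω) (e ω))
    (g : L2 d) (i : Fin n) :
    MemLp (fun ω => ⟪spectralFiber g ω, spectralFiber (φ i) ω⟫_ℂ) 2 (cubeMeasure d) := by
  have hm := (integrable_inner_spectralFiber g (φ i)).aestronglyMeasurable
  rw [memLp_two_iff_integrable_sq_norm hm]
  refine (integrable_norm_sq_spectralFiber g).mono (hm.norm.pow 2) ?_
  filter_upwards [hφ] with ω hω
  simp only [norm_pow, norm_norm]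
  refine pow_le_pow_left₀ (norm_nonneg _) ?_ 2
  exact (norm_inner_le_norm _ _).trans (mul_le_of_le_one_right (norm_nonneg _) (hω.norm_le_one i))

theorem integrable_norm_sq_inner_spectralFiber
    (hφ : ∀ᵐ ω ∂cubeMeasure d, PartialOrthonormal (fun i => spectralFiber (φ i) ω) (e ω))
    (g : L2 d) (i : Fin n) :
    Integrable (fun ω => ‖⟪spectralFiber (φ i) ω, spectralFiber g ω⟫_ℂ‖ ^ 2) (cubeMeasure d) := by
  have h := memLp_inner_spectralFiber hφ g i
  simpa only [norm_inner_symm] using (memLp_two_iff_integrable_sq_norm h.1).1 h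

/-- For fixed `i` the inner products with the translates are the Fourier coefficients of the
fiberwise inner product, a square integrable function on the cube since the fibers of `φ i` have
norm at most one. -/
theorem hasSum_sq_inner_translate
    (hφ : ∀ᵐ ω ∂cubeMeasure d, PartialOrthonormal (fun i => spectralFiber (φ i) ω) (e ω))
    (g : L2 d) :
    HasSum (fun p : Fin n × (Fin d → ℤ) => ‖⟪g, translate p.2 (φ p.1)⟫_ℂ‖ ^ 2)
      (∑ i, ∫ ω in unitCube d, ‖⟪spectralFiber (φ i) ω, spectralFiber g ω⟫_ℂ‖ ^ 2) := by
  have h1 : ∀ i, HasSum (fun k : Fin d → ℤ => ‖⟪g, translate k (φ i)⟫_ℂ‖ ^ 2)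
      (∫ ω in unitCube d, ‖⟪spectralFiber (φ i) ω, spectralFiber g ω⟫_ℂ‖ ^ 2) := fun i => by
    have hL := memLp_inner_spectralFiber hφ g i
    obtain ⟨c, hc, hce⟩ := hL.1
    have key := hasSum_sq_phase_integral hc.measurable (hL.ae_eq hce)
    have h2 : ∀ k : Fin d → ℤ, ∫ ω in unitCube d, phase k ω * c ω = ⟪g, translate k (φ i)⟫_ℂ :=
      fun k => by
        rw [inner_translate]
        refine integral_congr_ae ?_
        filter_upwards [hce] with ω hω
        rw [hω]
    have h3 : ∫ ω in unitCube d, ‖c ω‖ ^ 2 =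
        ∫ ω in unitCube d, ‖⟪spectralFiber (φ i) ω, spectralFiber g ω⟫_ℂ‖ ^ 2 := by
      refine integral_congr_ae ?_
      filter_upwards [hce] with ω hω
      rw [← hω, norm_inner_symm]
    simpa only [h2, h3] using key
  have hs : Summable fun p : Fin n × (Fin d → ℤ) => ‖⟪g, translate p.2 (φ p.1)⟫_ℂ‖ ^ 2 :=
    (summable_prod_of_nonneg fun p => sq_nonneg _).2
      ⟨fun i => (h1 i).summable, (hasSum_fintype _).summable⟩
  have h4 := (hs.hasSum.prod_fiberwise h1).unique (hasSum_fintype _)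
  exact h4 ▸ hs.hasSum

/-- The fibers of a member of the space lie in the span of the generator fibers, where a partially
orthonormal family satisfies Parseval's identity; it remains to integrate. -/
theorem isParsevalFrame_of_partialOrthonormal
    (hφ : ∀ᵐ ω ∂cubeMeasure d, PartialOrthonormal (fun i => spectralFiber (φ i) ω) (e ω)) :
    IsParsevalFrame (fun p : Fin n × (Fin d → ℤ) => translate p.2 (φ p.1)) (siSpace φ) := by
  refine ⟨translate_mem_siSpace φ, fun g hg => ?_⟩
  have h := hasSum_sq_inner_translate hφ g
  rw [← integral_finsetSum _ fun i _ => integrable_norm_sq_inner_spectralFiber hφ g i] at h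
  rw [← integral_norm_sq_spectralFiber]
  have heq : ∫ ω in unitCube d, ∑ i, ‖⟪spectralFiber (φ i) ω, spectralFiber g ω⟫_ℂ‖ ^ 2 =
      ∫ ω in unitCube d, ‖spectralFiber g ω‖ ^ 2 := by
    refine integral_congr_ae ?_
    filter_upwards [hφ, spectralFiber_mem_of_mem_siSpace φ hg] with ω h1 h2
    exact h1.sum_sq_inner_of_mem_span h2
  rwa [heq] at h

theorem norm_sub_starProjection_sq
    (hφ : ∀ᵐ ω ∂cubeMeasure d, PartialOrthonormal (fun i => spectralFiber (φ i) ω) (e ω))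
    (g : L2 d) :
    ‖g - (siSpace φ).toSubmodule.starProjection g‖ ^ 2 = ‖g‖ ^ 2 -
      ∑ i, ∫ ω in unitCube d, ‖⟪spectralFiber (φ i) ω, spectralFiber g ω⟫_ℂ‖ ^ 2 := by
  set V := (siSpace φ).toSubmodule
  have h1 := V.norm_sq_eq_add_norm_sq_starProjection g
  rw [Submodule.starProjection_orthogonal', sub_apply, one_apply_eq_self] at h1
  have hmem : V.starProjection g ∈ siSpace φ := V.starProjection_apply_mem g
  have h2 := (isParsevalFrame_of_partialOrthonormal hφ).2 _ hmem
  -- The projection is self-adjoint and fixes the translates, so the frame identity for the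
  -- projection of `g` computes its norm from `g` itself.
  have h3 : ∀ p : Fin n × (Fin d → ℤ), ⟪V.starProjection g, translate p.2 (φ p.1)⟫_ℂ =
      ⟪g, translate p.2 (φ p.1)⟫_ℂ := fun p => by
    have hp : translate p.2 (φ p.1) ∈ V := translate_mem_siSpace φ p
    rw [Submodule.inner_starProjection_left_eq_right, Submodule.starProjection_eq_self_iff.2 hp]
  simp only [h3] at h2
  have h4 := h2.unique (hasSum_sq_inner_translate hφ g)
  linarith

end SpectralFiber

section Gramian

open scoped ENNReal InnerProductSpace

variable {d m : ℕ}

/-! ### The Gramian and its eigenvalues -/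

/-- The Gramian as a Hermitian matrix. -/
noncomputable def hermitianGramian (f : Fin m → L2 d) (ω : Rd d) : HermitianMatrix m :=
  ⟨fun i j => gramian f ω i j, gramian_isHermitian f ω⟩

theorem measurable_hermitianGramian (f : Fin m → L2 d) : Measurable (hermitianGramian f) :=
  Measurable.subtype_mk <| measurable_pi_lambda _ fun i => measurable_pi_lambda _ fun j =>
    measurable_tsum_translates
      ((measurable_coeFn (𝓕 (f i))).mul
        (continuous_star.measurable.comp (measurable_coeFn (𝓕 (f j)))))

theorem gramian_add_intVec (f : Fin m → L2 d) (k : Fin d → ℤ) (ω : Rd d) :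
    gramian f (ω + intVec k) = gramian f ω := by
  ext i j
  simp only [gramian, Matrix.of_apply, add_assoc, ← intVec_add]
  exact (Equiv.addLeft k).tsum_eq fun l =>
    (𝓕 (f i) : L2 d) (ω + intVec l) * star ((𝓕 (f j) : L2 d) (ω + intVec l))

theorem hermitianGramian_add_intVec (f : Fin m → L2 d) (k : Fin d → ℤ) (ω : Rd d) :
    hermitianGramian f (ω + intVec k) = hermitianGramian f ω :=
  Subtype.ext (gramian_add_intVec f k ω)

/-- The eigenvalues of a Hermitian matrix, in decreasing order. -/
noncomputable def sortedEigenvalue (A : HermitianMatrix m) (i : Fin m) : ℝ :=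
  A.2.eigenvalues₀ (Fin.cast (Fintype.card_fin m).symm i)

theorem gramEigenvalue_eq (f : Fin m → L2 d) (i : Fin m) (ω : Rd d) :
    gramEigenvalue f i ω = sortedEigenvalue (hermitianGramian f ω) i := rfl

theorem gramEigenvalue_add_intVec (f : Fin m → L2 d) (i : Fin m) (k : Fin d → ℤ) (ω : Rd d) :
    gramEigenvalue f i (ω + intVec k) = gramEigenvalue f i ω := by
  rw [gramEigenvalue_eq, gramEigenvalue_eq, hermitianGramian_add_intVec]

theorem antitone_gramEigenvalue (f : Fin m → L2 d) (ω : Rd d) :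
    Antitone fun i => gramEigenvalue f i ω :=
  fun _ _ h => (gramian_isHermitian f ω).eigenvalues₀_antitone h

theorem measurable_sortedEigenvalue (i : Fin m) :
    Measurable fun A : HermitianMatrix m => sortedEigenvalue A i := by
  obtain ⟨y, hy, hon, heig⟩ := exists_measurable_eigenvectors m
  have hyj : ∀ j, Measurable fun A => y A i j := fun j =>
    (measurable_pi_apply j).comp ((measurable_pi_apply i).comp hy)
  -- The eigenvalue is the Rayleigh quotient of a measurably chosen unit eigenvector.
  have h : ∀ A, sortedEigenvalue A i =
      (∑ j, (∑ k, y A i k * A.1 k j) * star (y A i j)).re := fun A => by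
    have h1 : ∀ j, ∑ k, y A i k * A.1 k j = sortedEigenvalue A i * y A i j := fun j =>
      congrFun (heig A i) j
    simp only [h1, mul_assoc, ← Finset.mul_sum, hon]
    simp
  simp only [funext h]
  refine Complex.measurable_re.comp (Finset.measurable_sum _ fun j _ => Measurable.mul
    (Finset.measurable_sum _ fun k _ => (hyj k).mul ?_)
    (continuous_star.measurable.comp (hyj j)))
  exact (measurable_pi_apply j).comp ((measurable_pi_apply k).comp measurable_subtype_coe)

theorem measurable_gramEigenvalue (f : Fin m → L2 d) (i : Fin m) :
    Measurable (gramEigenvalue f i) := by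
  rw [funext (gramEigenvalue_eq f i)]
  exact (measurable_sortedEigenvalue i).comp (measurable_hermitianGramian f)

/-- At almost every `ω`, the Gramian is the Gram matrix of the fibers of the data. -/
theorem ae_gramian_eq (f : Fin m → L2 d) : ∀ᵐ ω ∂cubeMeasure d, ∀ i j,
    gramian f ω i j = ⟪spectralFiber (f j) ω, spectralFiber (f i) ω⟫_ℂ := by
  filter_upwards [ae_all_iff.2 fun i => ae_hasFiber_fourier (f i)] with ω hω i j
  exact ((hω j).inner_fiber (hω i)).symm

/-- A family of orthonormal left eigenvectors of the Gramian. -/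
structure IsEigenframe (f : Fin m → L2 d) (y : Rd d → Fin m → Fin m → ℂ) : Prop where
  measurable : Measurable y
  periodic : ∀ (k : Fin d → ℤ) ω, y (ω + intVec k) = y ω
  orthonormal : ∀ ω a b, ∑ j, y ω a j * star (y ω b j) = if a = b then 1 else 0
  eigen : ∀ ω a, Matrix.vecMul (y ω a) (gramian f ω) = (gramEigenvalue f a ω : ℂ) • y ω a

theorem exists_isEigenframe (f : Fin m → L2 d) : ∃ y, IsEigenframe f y := by
  obtain ⟨y, hy, hon, heig⟩ := exists_measurable_eigenvectors m
  exact ⟨fun ω => y (hermitianGramian f ω), hy.comp (measurable_hermitianGramian f),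
    fun k ω => by rw [hermitianGramian_add_intVec], fun ω => hon _,
    fun ω a => heig (hermitianGramian f ω) a⟩

variable {f : Fin m → L2 d} {y : Rd d → Fin m → Fin m → ℂ}

theorem IsEigenframe.ae_diagonalizesGram (hy : IsEigenframe f y) : ∀ᵐ ω ∂cubeMeasure d,
    DiagonalizesGram (fun i => spectralFiber (f i) ω) (y ω) fun a => gramEigenvalue f a ω := by
  filter_upwards [ae_gramian_eq f] with ω hω
  refine ⟨hy.orthonormal ω, fun a j => ?_, antitone_gramEigenvalue f ω⟩
  have := congrFun (hy.eigen ω a) j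
  simpa only [Matrix.vecMul, dotProduct, hω, Pi.smul_apply, smul_eq_mul] using this

/-- Each eigenvalue lies between zero and the trace, which is the sum of the squared norms of the
data fibers. -/
theorem integrable_gramEigenvalue (f : Fin m → L2 d) (i : Fin m) :
    Integrable (gramEigenvalue f i) (cubeMeasure d) := by
  obtain ⟨y, hy⟩ := exists_isEigenframe f
  have hint : Integrable (fun ω => ∑ j, ‖spectralFiber (f j) ω‖ ^ 2) (cubeMeasure d) :=
    integrable_finsetSum _ fun j _ => integrable_norm_sq_spectralFiber (f j)
  refine hint.mono' (measurable_gramEigenvalue f i).aestronglyMeasurable ?_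
  filter_upwards [hy.ae_diagonalizesGram] with ω hω
  rw [Real.norm_of_nonneg (hω.nonneg i), hω.sum_norm_sq]
  exact Finset.single_le_sum (fun a _ => hω.nonneg a) (Finset.mem_univ i)

theorem sum_norm_sq_eq (f : Fin m → L2 d) :
    ∑ j, ‖f j‖ ^ 2 = ∑ a, ∫ ω in unitCube d, gramEigenvalue f a ω := by
  obtain ⟨y, hy⟩ := exists_isEigenframe f
  rw [← integral_finsetSum _ fun a _ => integrable_gramEigenvalue f a]
  simp only [← integral_norm_sq_spectralFiber]
  rw [← integral_finsetSum _ fun j _ => integrable_norm_sq_spectralFiber (f j)]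
  refine integral_congr_ae ?_
  filter_upwards [hy.ae_diagonalizesGram] with ω hω
  exact hω.sum_norm_sq

/-! ### The lower bound -/

/-- The error is the integral of the fiberwise errors, and Eckart–Young applies at almost every ω.
Indices start at zero, so `n ≤ a` picks the eigenvalues numbered `n + 1` to `m`. -/
theorem sum_tail_le_approxError (f : Fin m → L2 d) {n : ℕ} (hnm : n ≤ m)
    {V : ClosedSubmodule ℂ (L2 d)} (hV : V ∈ siSpaces d n) :
    ∑ a : Fin m with n ≤ a.val, ∫ ω in unitCube d, gramEigenvalue f a ω ≤ approxError f V := by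
  obtain ⟨s, hs, ψ, rfl⟩ := hV
  obtain ⟨y, hy⟩ := exists_isEigenframe f
  set g : Fin m → L2 d := fun i => (siSpace ψ).toSubmodule.starProjection (f i)
  have hg : ∀ i, g i ∈ siSpace ψ := fun i => Submodule.starProjection_apply_mem _ _
  have herr : approxError f (siSpace ψ) =
      ∫ ω in unitCube d, ∑ i, ‖spectralFiber (f i - g i) ω‖ ^ 2 := by
    rw [integral_finsetSum _ fun i _ => integrable_norm_sq_spectralFiber (f i - g i)]
    simp only [integral_norm_sq_spectralFiber]
    rfl
  rw [herr, ← integral_finsetSum _ fun a _ => integrable_gramEigenvalue f a]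
  refine integral_mono_ae (integrable_finsetSum _ fun a _ => integrable_gramEigenvalue f a)
    (integrable_finsetSum _ fun i _ => integrable_norm_sq_spectralFiber (f i - g i)) ?_
  filter_upwards [hy.ae_diagonalizesGram,
    ae_all_iff.2 fun i => spectralFiber_mem_of_mem_siSpace ψ (hg i),
    ae_all_iff.2 fun i => spectralFiber_sub (f i) (g i)] with ω h1 h2 h3
  simp only [h3]
  exact h1.sum_tail_le hnm (fiberSpan ψ ω) ((finrank_fiberSpan_le ψ ω).trans hs) h2

/-! ### The generators of an optimal space -/

/-- The normalized combination of the Fourier transforms of the data with an eigenvector. -/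
noncomputable def generatorFourier (f : Fin m → L2 d) (y : Rd d → Fin m → Fin m → ℂ) (a : Fin m)
    (ω : Rd d) : ℂ :=
  (sigmaTilde f a ω : ℂ) * ∑ j, y ω a j * (𝓕 (f j) : L2 d) ω

theorem sigmaTilde_eq (f : Fin m → L2 d) (a : Fin m) (ω : Rd d) :
    sigmaTilde f a ω = DiagonalizesGram.normalizer (gramEigenvalue f a ω) := rfl

theorem sigmaTilde_add_intVec (f : Fin m → L2 d) (a : Fin m) (k : Fin d → ℤ) (ω : Rd d) :
    sigmaTilde f a (ω + intVec k) = sigmaTilde f a ω := by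
  rw [sigmaTilde_eq, sigmaTilde_eq, gramEigenvalue_add_intVec]

theorem measurable_sigmaTilde (f : Fin m → L2 d) (a : Fin m) : Measurable (sigmaTilde f a) :=
  Measurable.ite ((measurable_gramEigenvalue f a) (measurableSet_singleton 0)) measurable_const
    ((measurable_gramEigenvalue f a).pow_const _)

theorem IsEigenframe.measurable_generatorFourier (hy : IsEigenframe f y) (a : Fin m) :
    Measurable (generatorFourier f y a) :=
  (Complex.measurable_ofReal.comp (measurable_sigmaTilde f a)).mul <|
    Finset.measurable_sum _ fun j _ =>
      ((measurable_pi_apply j).comp ((measurable_pi_apply a).comp hy.measurable)).mul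
        (measurable_coeFn _)

theorem IsEigenframe.ae_fiber_generatorFourier (hy : IsEigenframe f y) (a : Fin m) :
    ∀ᵐ ω ∂cubeMeasure d, HasFiber (generatorFourier f y a) ω ∧
      fiber (generatorFourier f y a) ω =
        (DiagonalizesGram.normalizer (gramEigenvalue f a ω) : ℂ) •
          ∑ j, y ω a j • spectralFiber (f j) ω := by
  filter_upwards [ae_all_iff.2 fun i => ae_hasFiber_fourier (f i)] with ω hω
  have hp : ∀ (j : Fin m) (k : Fin d → ℤ), y (ω + intVec k) a j = y ω a j := fun j k => by
    rw [hy.periodic]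
  have hs : ∀ k : Fin d → ℤ, (sigmaTilde f a (ω + intVec k) : ℂ) = sigmaTilde f a ω := fun k => by
    rw [sigmaTilde_add_intVec]
  have h1 : ∀ j, HasFiber (fun x => y x a j * (𝓕 (f j) : L2 d) x) ω := fun j =>
    (hω j).periodic_mul (c := fun x => y x a j) (hp j)
  have h2 : HasFiber (fun x => ∑ j, y x a j * (𝓕 (f j) : L2 d) x) ω :=
    HasFiber.sum fun j _ => h1 j
  refine ⟨h2.periodic_mul hs, ?_⟩
  unfold generatorFourier
  rw [h2.fiber_periodic_mul hs, HasFiber.fiber_sum fun j _ => h1 j]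
  congr 1
  refine Finset.sum_congr rfl fun j _ => ?_
  rw [(hω j).fiber_periodic_mul (c := fun x => y x a j) (hp j)]
  rfl

theorem volume_unitCube_lt_top : volume (unitCube d) < ∞ := by
  have h : unitCube d = (WithLp.ofLp : Rd d → Fin d → ℝ) ⁻¹' Set.Icc 0 1 := by
    ext; simp [unitCube, Pi.le_def, forall_and]
  rw [h, (PiLp.volume_preserving_ofLp (Fin d)).measure_preimage measurableSet_Icc.nullMeasurableSet]
  exact isCompact_Icc.measure_lt_top

/-- The squared norm is the integral of the squared fiber norms over a cube of finite measure. -/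
theorem memLp_of_norm_fiber_le_one {u : Rd d → ℂ} (hm : Measurable u)
    (hu : ∀ᵐ ω ∂cubeMeasure d, HasFiber u ω ∧ ‖fiber u ω‖ ≤ 1) : MemLp u 2 := by
  refine ⟨hm.aestronglyMeasurable, ?_⟩
  rw [eLpNorm_lt_top_iff_lintegral_rpow_enorm_lt_top (by simp) (by simp)]
  simp only [ENNReal.toReal_ofNat, ENNReal.rpow_ofNat]
  rw [← lintegral_cube_tsum (hm.enorm.pow_const 2)]
  refine lt_of_le_of_lt (lintegral_mono_ae (g := fun _ => 1) ?_) ?_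
  · filter_upwards [hu] with ω hω
    have h1 : ∀ k : Fin d → ℤ, ‖u (ω + intVec k)‖ₑ ^ 2 =
        ENNReal.ofReal (‖u (ω + intVec k)‖ ^ 2) := fun k => by
      rw [ENNReal.ofReal_pow (norm_nonneg _), ofReal_norm]
    simp only [h1]
    rw [← ENNReal.ofReal_tsum_of_nonneg (fun k => sq_nonneg _) (hasFiber_iff.1 hω.1),
      ← hω.1.norm_fiber_sq]
    exact ENNReal.ofReal_le_one.2 (pow_le_one₀ (norm_nonneg _) hω.2)
  · simpa using volume_unitCube_lt_top

theorem IsEigenframe.memLp_generatorFourier (hy : IsEigenframe f y) (a : Fin m) :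
    MemLp (generatorFourier f y a) 2 := by
  refine memLp_of_norm_fiber_le_one (hy.measurable_generatorFourier a) ?_
  filter_upwards [hy.ae_fiber_generatorFourier a, hy.ae_diagonalizesGram] with ω h1 h2
  refine ⟨h1.1, ?_⟩
  rw [h1.2]
  exact h2.partialOrthonormal.norm_le_one a

/-- The generator of an optimal space which belongs to an eigenvalue of the Gramian. -/
noncomputable def IsEigenframe.generator (hy : IsEigenframe f y) (a : Fin m) : L2 d :=
  𝓕⁻ (hy.memLp_generatorFourier a).toLp

theorem IsEigenframe.fourier_generator (hy : IsEigenframe f y) (a : Fin m) :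
    (𝓕 (hy.generator a) : L2 d) =ᵐ[volume] generatorFourier f y a := by
  rw [IsEigenframe.generator, FourierTransform.fourier_fourierInv_eq]
  exact MemLp.coeFn_toLp _

theorem IsEigenframe.ae_spectralFiber_generator (hy : IsEigenframe f y) (a : Fin m) :
    ∀ᵐ ω ∂cubeMeasure d, spectralFiber (hy.generator a) ω =
        (DiagonalizesGram.normalizer (gramEigenvalue f a ω) : ℂ) •
          ∑ j, y ω a j • spectralFiber (f j) ω := by
  filter_upwards [fiber_congr (hy.fourier_generator a), hy.ae_fiber_generatorFourier a]
    with ω h1 h2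
  rw [spectralFiber, h1, h2.2]

variable {n : ℕ} (hnm : n ≤ m)

theorem IsEigenframe.ae_partialOrthonormal (hy : IsEigenframe f y) : ∀ᵐ ω ∂cubeMeasure d,
    PartialOrthonormal (fun i : Fin n => spectralFiber (hy.generator (Fin.castLE hnm i)) ω)
      fun i => gramEigenvalue f (Fin.castLE hnm i) ω ≠ 0 := by
  filter_upwards [ae_all_iff.2 fun a => hy.ae_spectralFiber_generator a,
    hy.ae_diagonalizesGram] with ω h1 h2 i j
  simp only [h1]
  have := h2.partialOrthonormal (Fin.castLE hnm i) (Fin.castLE hnm j)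
  simpa only [(Fin.castLE_injective hnm).eq_iff] using this

theorem sum_castLE_add_sum_tail (g : Fin m → ℝ) :
    ∑ i : Fin n, g (Fin.castLE hnm i) + ∑ a : Fin m with n ≤ a.val, g a = ∑ a, g a := by
  rw [← Finset.sum_filter_add_sum_filter_not Finset.univ (fun a : Fin m => a.val < n) g]
  simp only [not_lt]
  congr 1
  refine Finset.sum_nbij (Fin.castLE hnm) (fun i _ => by simp)
    (Fin.castLE_injective hnm).injOn (fun a ha => ?_) fun _ _ => rfl
  exact ⟨⟨a, by simpa using ha⟩, by simp, rfl⟩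

/-- The data have total energy equal to the sum of all integrated eigenvalues, and the generator
numbered `i` captures exactly the integral of its own eigenvalue. -/
theorem IsEigenframe.approxError_eq (hy : IsEigenframe f y) :
    approxError f (siSpace fun i : Fin n => hy.generator (Fin.castLE hnm i)) =
      ∑ a : Fin m with n ≤ a.val, ∫ ω in unitCube d, gramEigenvalue f a ω := by
  have hpo := hy.ae_partialOrthonormal hnm
  have h1 : ∀ i : Fin n, ∑ j, ∫ ω in unitCube d,
      ‖⟪spectralFiber (hy.generator (Fin.castLE hnm i)) ω, spectralFiber (f j) ω⟫_ℂ‖ ^ 2 =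
      ∫ ω in unitCube d, gramEigenvalue f (Fin.castLE hnm i) ω := fun i => by
    rw [← integral_finsetSum _ fun j _ => integrable_norm_sq_inner_spectralFiber hpo (f j) i]
    refine integral_congr_ae ?_
    filter_upwards [hy.ae_spectralFiber_generator (Fin.castLE hnm i),
      hy.ae_diagonalizesGram] with ω h1 h2
    rw [h1]
    exact h2.sum_norm_sq_inner_eq _
  simp only [approxError, norm_sub_starProjection_sq hpo]
  rw [Finset.sum_sub_distrib, Finset.sum_comm]
  simp only [h1]
  rw [sum_norm_sq_eq, ← sum_castLE_add_sum_tail hnm]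
  ring

end Gramian

end ShiftInvariant

/-! ### The main theorem -/

open ShiftInvariant
theorem theorem2p2 (d m n : ℕ) (hnm : n ≤ m) (f : Fin m → L2 d) :
    -- the eigenvalues are periodic, measurable and integrable on the unit cube
    (∀ i : Fin m,
      (∀ (k : Fin d → ℤ) (ω : Rd d), gramEigenvalue f i (ω + intVec k) = gramEigenvalue f i ω) ∧
      Measurable (gramEigenvalue f i) ∧
      IntegrableOn (gramEigenvalue f i) (unitCube d) volume) ∧
    -- the minimal error
    IsLeast (approxError f '' siSpaces d n)
      (∑ i : Fin m with n ≤ i.val, ∫ ω in unitCube d, gramEigenvalue f i ω) ∧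
    -- measurable orthonormal left eigenvectors and the generators of an optimal space
    ∃ y : Fin n → Rd d → Fin m → ℂ,
      (∀ i, Measurable (y i)) ∧
      (∀ i ω, Matrix.vecMul (y i ω) (gramian f ω) =
        (gramEigenvalue f (Fin.castLE hnm i) ω : ℂ) • y i ω) ∧
      (∀ i i' ω, ∑ j, y i ω j * star (y i' ω j) = if i = i' then 1 else 0) ∧
      (∀ i, MemLp (fun ω => (sigmaTilde f (Fin.castLE hnm i) ω : ℂ) *
        ∑ j, y i ω j * (𝓕 (f j) : L2 d) ω) 2 volume) ∧
      ∃ φ : Fin n → L2 d,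
        (∀ i, ((𝓕 (φ i) : L2 d) : Rd d → ℂ) =ᵐ[volume] fun ω =>
          (sigmaTilde f (Fin.castLE hnm i) ω : ℂ) * ∑ j, y i ω j * (𝓕 (f j) : L2 d) ω) ∧
        IsOptimal f n (siSpace φ) ∧
        IsParsevalFrame (fun p : Fin n × (Fin d → ℤ) => translate p.2 (φ p.1)) (siSpace φ) := by
  obtain ⟨y, hy⟩ := exists_isEigenframe f
  have hmem : siSpace (fun i : Fin n => hy.generator (Fin.castLE hnm i)) ∈ siSpaces d n :=
    ⟨n, le_rfl, _, rfl⟩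
  refine ⟨fun i => ⟨gramEigenvalue_add_intVec f i, measurable_gramEigenvalue f i,
    integrable_gramEigenvalue f i⟩, ⟨⟨_, hmem, hy.approxError_eq hnm⟩, ?_⟩,
    fun i ω => y ω (Fin.castLE hnm i), fun i => (measurable_pi_apply _).comp hy.measurable,
    fun i ω => hy.eigen ω _, fun i i' ω => ?_, fun i => hy.memLp_generatorFourier _,
    fun i => hy.generator (Fin.castLE hnm i), fun i => hy.fourier_generator _,
    ⟨hmem, fun V' hV' => ?_⟩,
    isParsevalFrame_of_partialOrthonormal (hy.ae_partialOrthonormal hnm)⟩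
  · rintro _ ⟨V, hV, rfl⟩
    exact sum_tail_le_approxError f hnm hV
  · rw [hy.orthonormal]
    simp only [(Fin.castLE_injective hnm).eq_iff]
  · rw [hy.approxError_eq hnm]
    exact sum_tail_le_approxError f hnm hV'
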